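/- Let $1\le m<n$, $d\ge 0$ and $D\ge 0$ be integers. For $\alpha=(\alpha_{k,r})\in(\mathbb C^m)^{n-m}$ and $\beta\in\mathbb C^{n-m}$ let $$L_{\alpha,\beta}=\Big\{\zeta\in\mathbb C^n:\ \zeta_k=\sum_{r=1}^m\alpha_{k,r}\,\zeta_{n-m+r}+\beta_k,\ k=1,\dots,n-m\Big\},$$ an $m$-dimensional affine subspace. Let $\gamma_1,\dots,\gamma_d\subset\mathbb C^n$ be pairwise disjoint pieces of $(n-m)$-dimensional complex analytic manifolds (locally closed complex submanifolds), and suppose that for all $(\alpha,\beta)$ close to $(0,0)$ and all $j$ the subspace $L_{\alpha,\beta}$ meets $\gamma_j$ in exactly one point $p_j(\alpha,\beta)$, and transversally there. Suppose that there are functions $h^{(l)}_{\underline k}$ ($n-m<l\le n$, $\underline k\in\mathbb N^{n-m}$, $|\underline k|\le D+1$), analytic in a neighbourhood of $0$ in $(\mathbb C^m)^{n-m}$, such that for all $(\alpha,\beta)$ close to $(0,0)$ and $l=n-m+1,\dots,n$ $$\sum_{j=1}^d\zeta_l[p_j(\alpha,\beta)]=\sum_{|\underline k|\le D+1}h^{(l)}_{\underline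 k}(\alpha)\,\beta_1^{k_1}\cdots\beta_{n-m}^{k_{n-m}},$$ where $\zeta_l[p]$ is the $l$-th coordinate of $p$. Then there are a finite family $(P_\iota)_{\iota\in\mathcal J}$ of polynomials in $\mathbb C[X_1,\dots,X_n]$, each of degree at most $d+D$, with common zero set $V(P)\subset\mathbb C^n$, and constants $\epsilon,\kappa,K>0$ such that: (i) if $\Gamma_\epsilon$ denotes the union of all $L_{\alpha,\beta}$ with $\max(\|\alpha\|,\|\beta\|)<\epsilon$, then for every $\zeta\in\Gamma_\epsilon$ with $\|\zeta\|\ge K$ one has $\max_{\iota\in\mathcal J}|P_\iota(\zeta)|\ge\kappa\|\zeta\|^d$; (ii) whenever $\max(\|\alpha\|,\|\beta\|)<\epsilon$, one has $L_{\alpha,\beta}\cap V(P)=\{p_1(\alpha,\beta),\dots,p_d(\alpha,\beta)\}$. Here $\|\zeta\|$ is the Euclidean norm, and $\|\alpha\|,\|\beta\|$ are the maximum norms (the choice of norms does not affect the statement). -/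

import Mathlib

open Filter Topology

namespace AffineWood

/-- `Φ` is a system of `m` local holomorphic equations for `γ ⊆ ℂⁿ` near the point `p`, with
linearly independent differentials at `p`: near `p`, the set `γ` is `{Φ₁ = ⋯ = Φₘ = 0}`. -/
def IsLocalEquation {n m : ℕ} (γ : Set (Fin n → ℂ)) (p : Fin n → ℂ)
    (Φ : (Fin n → ℂ) → (Fin m → ℂ)) : Prop :=
  AnalyticAt ℂ Φ p ∧ Function.Surjective (fderiv ℂ Φ p) ∧ ∀ᶠ z in 𝓝 p, (z ∈ γ ↔ Φ z = 0)

/-- `γ` is a piece of complex analytic manifold in `ℂⁿ`, of codimension `m`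
(so of dimension `n - m`): a locally closed complex submanifold. -/
def IsAnalyticPiece {n : ℕ} (m : ℕ) (γ : Set (Fin n → ℂ)) : Prop :=
  ∀ p ∈ γ, ∃ Φ : (Fin n → ℂ) → (Fin m → ℂ), IsLocalEquation γ p Φ

/-- An affine subspace through `p` with direction `V` is transversal at `p` to the piece `γ` of
codimension `m`: the tangent space of `γ` at `p`, which is the kernel of the differential at `p`
of any system `Φ` of local equations, spans `ℂⁿ` together with `V`. -/
def IsTransversalAt {n : ℕ} (m : ℕ) (γ : Set (Fin n → ℂ)) (V : Submodule ℂ (Fin n → ℂ))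
    (p : Fin n → ℂ) : Prop :=
  ∃ Φ : (Fin n → ℂ) → (Fin m → ℂ), IsLocalEquation γ p Φ ∧
    LinearMap.ker (fderiv ℂ Φ p).toLinearMap ⊔ V = ⊤

/-- The `m`-dimensional affine subspace `L_{α,β}` of `ℂⁿ`, where `n = q + m`, given by
`ζ_k = ∑_r α_{k,r} ζ_{q+r} + β_k` for `k = 1, …, q`. -/
def affL {q m : ℕ} (α : Fin q → Fin m → ℂ) (β : Fin q → ℂ) : Set (Fin (q + m) → ℂ) :=
  {ζ | ∀ k : Fin q, ζ (Fin.castAdd m k) = ∑ r : Fin m, α k r * ζ (Fin.natAdd q r) + β k}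

/-- The direction of `L_{α,β}`, that is the linear subspace `L_{α,0}`. -/
def dirL {q m : ℕ} (α : Fin q → Fin m → ℂ) : Submodule ℂ (Fin (q + m) → ℂ) where
  carrier := affL α 0
  zero_mem' := by intro k; simp
  add_mem' := by
    intro a b ha hb k
    have h1 := ha k
    have h2 := hb k
    simp only [Pi.zero_apply, add_zero] at h1 h2 ⊢
    simp only [Pi.add_apply, h1, h2, mul_add, Finset.sum_add_distrib]
  smul_mem' := by
    intro c a ha k
    have h1 := ha k
    simp only [Pi.zero_apply, add_zero] at h1 ⊢
    simp only [Pi.smul_apply, smul_eq_mul, h1, Finset.mul_sum]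
    exact Finset.sum_congr rfl fun r _ => by ring

/-- The tube `Γ_ε`, the union of the `L_{α,β}` with `max (‖α‖, ‖β‖) < ε`. -/
def tube (q m : ℕ) (ε : ℝ) : Set (Fin (q + m) → ℂ) :=
  {ζ | ∃ (α : Fin q → Fin m → ℂ) (β : Fin q → ℂ), max ‖α‖ ‖β‖ < ε ∧ ζ ∈ affL α β}

/-- The multi-indices `k ∈ ℕ^q` with `|k| ≤ N`. -/
def multiIndices (q N : ℕ) : Finset (Fin q → ℕ) :=
  (Fintype.piFinset fun _ => Finset.range (N + 1)).filter fun k => ∑ i, k i ≤ N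

theorem mem_multiIndices {q N : ℕ} {k : Fin q → ℕ} :
    k ∈ multiIndices q N ↔ ∑ i, k i ≤ N := by
  simp only [multiIndices, Finset.mem_filter, Fintype.mem_piFinset, Finset.mem_range,
    and_iff_right_iff_imp]
  intro h i
  have := Finset.single_le_sum (f := k) (fun j _ => Nat.zero_le _) (Finset.mem_univ i)
  omega

/-- The common zero set `V(P)` in `ℂⁿ` of a family of polynomials. -/
def zeroSet {n : ℕ} {J : Type*} (P : J → MvPolynomial (Fin n) ℂ) : Set (Fin n → ℂ) :=
  {ζ | ∀ ι, MvPolynomial.eval ζ (P ι) = 0}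

/-- The Euclidean (Hermitian) norm on `ℂⁿ`. -/
noncomputable def euclNorm {n : ℕ} (ζ : Fin n → ℂ) : ℝ :=
  ‖(WithLp.toLp 2 ζ : EuclideanSpace ℂ (Fin n))‖

end AffineWood

/-! The hypotheses are used through the last coordinates `w j (α, β) ∈ ℂᵐ` of the intersection points
`p j α β`. Transversality and the implicit function theorem make them analytic in `(α, β)`
(`analyticAt_tail`), and uniqueness of the intersection point says that `w j` does not change when
`L_{α,β}` is turned about `p j α β` (`IsBranch`). Differentiating this statement, for a linear form
`c` on `ℂᵐ` the function `u = c ∘ w j` satisfies the inviscid Burgers equation `∂ₛ u = u ∂ₜ u` in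
the parameters `(α + s • (e ⊗ c), t • e)` (`IsBranch.fderiv_rankOne`). Therefore
`∂ₜ ∑ u ^ (l + 1) / (l + 1) = ∂ₛ ∑ u ^ l / l`, and since the first power sum is a polynomial of
degree at most `D + 1` in `t`, the power sum of order `l` has degree at most `l + D`
(`exists_psum_eq_of_burgers`).

Newton's identities express the elementary symmetric functions through the power sums, but this
alone gives the degree `d * (D + 1)` for `∏ j, (z * t - u j t)`. The bound `d + D` comes from the
power sums of order `d, 2 * d, …, d * d`: at every `t ∈ ℂ` they bound the `d`-th powers of the
continued values of the `u j` by a multiple of `max 1 |t| ^ (d + D)`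
(`exists_polynomial_prod_sub_eq`).

A function analytic at the origin that is a polynomial on each line is a polynomial, so for every
small `α` and every linear form `c` there is a polynomial `F α c` of degree at most `d + D` in
`ζ ∈ ℂⁿ`, equal to `∏ j, (c (tail ζ) - c (w j (α, β)))` on `L_{α,β}` for all small `β`
(`exists_mvPolynomial_prod_branch`). It also vanishes at the points `p j α' β'` with other small
`α'` and `β'`. The family `P` spans the space `W` of all polynomials of degree at most `d + D` that
vanish at these points; it is taken dual to evaluation at finitely many points near the origin
(`exists_interpolation`), where the `F α c` are bounded, so that the `F α c` are
combinations of the `P i` with bounded coefficients. The lower bound for `max |P i|` follows from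
the one for `F α c`, with `c` the largest coordinate of `tail ζ`. A point of `L_{α,β}` outside
`{p j α β}` is not a zero of `F α c` when `c` separates it from all the `p j α β`. -/

/-! ### Degree bounds from power sums -/

namespace AffineWood

open Polynomial in
theorem exists_norm_eval_le {G : ℂ[X]} {N : ℕ} (hG : G.natDegree ≤ N) :
    ∃ C : ℝ, 0 ≤ C ∧ ∀ z : ℂ, ‖G.eval z‖ ≤ C * max 1 ‖z‖ ^ N := by
  refine ⟨∑ i ∈ Finset.range (N + 1), ‖G.coeff i‖, Finset.sum_nonneg fun _ _ => norm_nonneg _,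
    fun z => ?_⟩
  rw [eval_eq_sum_range' (Nat.lt_succ_of_le hG), Finset.sum_mul]
  refine norm_sum_le_of_le _ fun i hi => ?_
  rw [norm_mul, norm_pow]
  have h1 : ‖z‖ ^ i ≤ max 1 ‖z‖ ^ N :=
    (pow_le_pow_left₀ (norm_nonneg z) (le_max_right 1 ‖z‖) i).trans
      (pow_le_pow_right₀ (le_max_left _ _) (by simpa [Nat.lt_succ_iff] using hi))
  gcongr

open Polynomial in
/-- A complex polynomial that grows at most like `|z| ^ N` has degree at most `N`. -/
theorem natDegree_le_of_norm_eval_le {G : ℂ[X]} {N : ℕ} {C : ℝ}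
    (hG : ∀ z : ℂ, ‖G.eval z‖ ≤ C * max 1 ‖z‖ ^ N) : G.natDegree ≤ N := by
  by_contra! hN
  have hmon : (X ^ N : ℂ[X]).Monic := monic_X_pow N
  obtain ⟨C', -, hC'⟩ := exists_norm_eval_le (G := G %ₘ X ^ N) (N := N) (by
    simpa using natDegree_modByMonic_le G hmon)
  have hdeg : 0 < (G /ₘ X ^ N).degree := by
    rw [← natDegree_pos_iff_degree_pos, natDegree_divByMonic G hmon, natDegree_X_pow]
    omega
  have hbound : ∀ z : ℂ, 1 ≤ ‖z‖ → ‖(G /ₘ X ^ N).eval z‖ ≤ C + C' := by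
    intro z hz
    have h1 := hG z
    have h2 := hC' z
    rw [max_eq_right hz] at h1 h2
    have h3 : z ^ N * (G /ₘ X ^ N).eval z = G.eval z - (G %ₘ X ^ N).eval z := by
      have := congrArg (eval z) (modByMonic_add_div G (X ^ N : ℂ[X]))
      rw [← this, eval_add, eval_mul, eval_pow, eval_X, add_sub_cancel_left]
    have h4 : ‖z‖ ^ N * ‖(G /ₘ X ^ N).eval z‖ ≤ ‖z‖ ^ N * (C + C') := by
      rw [← norm_pow, ← norm_mul, h3]
      refine (norm_sub_le _ _).trans ?_
      rw [norm_pow]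
      linarith
    exact le_of_mul_le_mul_left h4 (by positivity)
  have hlim := (G /ₘ X ^ N).tendsto_norm_atTop hdeg (l := atTop) (z := fun n : ℕ => (n : ℂ))
    (by simpa using tendsto_natCast_atTop_atTop)
  obtain ⟨n, hn1, hn2⟩ := ((hlim.eventually_gt_atTop (C + C')).and (eventually_ge_atTop 1)).exists
  exact absurd (hbound n (by simpa using hn2)) (not_le.2 hn1)

/-- In characteristic zero a subalgebra that contains the power sums of a finite family contains
its elementary symmetric functions. -/
theorem aeval_esymm_mem {σ K A : Type*} [Fintype σ] [Field K] [CharZero K] [CommRing A]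
    [Algebra K A] (B : Subalgebra K A) (u : σ → A) (hu : ∀ l, 0 < l → ∑ j, u j ^ l ∈ B) (k : ℕ) :
    MvPolynomial.aeval u (MvPolynomial.esymm σ K k) ∈ B := by
  induction k using Nat.strong_induction_on with
  | _ k ih =>
    rcases Nat.eq_zero_or_pos k with rfl | hk
    · simp
    have h1 := congrArg (MvPolynomial.aeval u) (MvPolynomial.mul_esymm_eq_sum σ K k)
    simp only [map_mul, map_natCast, map_pow, map_neg, map_one, map_sum] at h1
    have h2 : (k : A) * MvPolynomial.aeval u (MvPolynomial.esymm σ K k) ∈ B := by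
      rw [h1]
      refine B.mul_mem (B.pow_mem (B.neg_mem B.one_mem) _) (B.sum_mem fun a ha => ?_)
      obtain ⟨ha1, ha2⟩ := Finset.mem_filter.1 ha
      rw [Finset.HasAntidiagonal.mem_antidiagonal] at ha1
      refine B.mul_mem (B.mul_mem (B.pow_mem (B.neg_mem B.one_mem) _) (ih _ ha2)) ?_
      simpa [MvPolynomial.psum] using hu a.2 (by omega)
    have h3 : MvPolynomial.aeval u (MvPolynomial.esymm σ K k) =
        (k : K)⁻¹ • ((k : A) * MvPolynomial.aeval u (MvPolynomial.esymm σ K k)) := by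
      rw [← smul_mul_assoc, ← map_natCast (algebraMap K A) k, Algebra.smul_def, ← map_mul,
        inv_mul_cancel₀ (by exact_mod_cast hk.ne'), map_one, one_mul]
    rw [h3]
    exact B.smul_mem h2 _

theorem prod_sub_eq_sum_esymm {d : ℕ} {K A : Type*} [CommRing K] [CommRing A] [Algebra K A]
    (x : Fin d → A) (t : A) :
    ∏ j, (t - x j) = ∑ k ∈ Finset.range (d + 1),
      (-1) ^ k * MvPolynomial.aeval x (MvPolynomial.esymm (Fin d) K k) * t ^ (d - k) := by
  have h := congrArg (Polynomial.eval t)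
    (Multiset.prod_X_sub_X_eq_sum_esymm (Finset.univ.val.map x))
  rw [Multiset.map_map] at h
  have hc : Multiset.card (Finset.univ.val.map x) = d := by simp
  rw [hc, Polynomial.eval_finsetSum] at h
  simp only [MvPolynomial.aeval_esymm_eq_multiset_esymm]
  have h2 : Polynomial.eval t (Multiset.map ((fun a => Polynomial.X - Polynomial.C a) ∘ x)
      Finset.univ.val).prod = ∏ j, (t - x j) := by
    change Polynomial.eval t (∏ j, (Polynomial.X - Polynomial.C (x j))) = _
    simp [Polynomial.eval_prod]
  rw [← h2]
  refine h.trans (Finset.sum_congr rfl fun k _ => ?_)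
  simp [mul_assoc]

/-- Elementary symmetric functions can be prescribed over `ℂ`. -/
theorem exists_aeval_esymm_eq {d : ℕ} (a : ℕ → ℂ) (ha : a 0 = 1) :
    ∃ x : Fin d → ℂ, ∀ k ≤ d, MvPolynomial.aeval x (MvPolynomial.esymm (Fin d) ℂ k) = a k := by
  set F : Polynomial ℂ := ∑ i ∈ Finset.range (d + 1),
    Polynomial.C ((-1) ^ (d - i) * a (d - i)) * Polynomial.X ^ i with hF
  have hcoeff : ∀ i, F.coeff i = if i ≤ d then (-1) ^ (d - i) * a (d - i) else 0 := by
    intro i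
    rw [hF, Polynomial.finsetSum_coeff]
    simp only [Polynomial.coeff_C_mul, Polynomial.coeff_X_pow]
    simp
  have hdeg : F.natDegree = d := by
    refine le_antisymm (Polynomial.natDegree_le_iff_coeff_eq_zero.2 fun i hi => ?_)
      (Polynomial.le_natDegree_of_ne_zero ?_)
    · rw [hcoeff, if_neg (by omega)]
    · rw [hcoeff]; simp [ha]
  have hlead : F.leadingCoeff = 1 := by
    rw [Polynomial.leadingCoeff, hdeg, hcoeff]; simp [ha]
  have hcard : Multiset.card F.roots = F.natDegree :=
    (Polynomial.splits_iff_card_roots.1 (IsAlgClosed.splits F))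
  obtain ⟨x, hx⟩ : ∃ x : Fin d → ℂ, Finset.univ.val.map x = F.roots := by
    have hl : F.roots.toList.length = d := by rw [Multiset.length_toList, hcard, hdeg]
    refine ⟨fun i => F.roots.toList.get (i.cast hl.symm), ?_⟩
    rw [Fin.univ_val_map]
    conv_rhs => rw [← Multiset.coe_toList F.roots]
    congr 1
    refine List.ext_getElem (by simp [hl]) fun i h1 h2 => by simp
  refine ⟨x, fun k hk => ?_⟩
  rw [MvPolynomial.aeval_esymm_eq_multiset_esymm, hx]
  have h := Polynomial.coeff_eq_esymm_roots_of_card hcard (k := d - k) (by omega)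
  rw [hlead, hcoeff, hdeg, if_pos (by omega), show d - (d - k) = k by omega, one_mul] at h
  exact (mul_left_cancel₀ (pow_ne_zero _ (by norm_num)) h).symm

/-- If the first `d` power sums of `d` complex numbers vanish, so do the numbers. -/
theorem eq_zero_of_psum_eq_zero {d : ℕ} (y : Fin d → ℂ)
    (hy : ∀ i ∈ Finset.Icc 1 d, ∑ j, y j ^ i = 0) : y = 0 := by
  have he : ∀ k ∈ Finset.Icc 1 d,
      MvPolynomial.aeval y (MvPolynomial.esymm (Fin d) ℂ k) = 0 := by
    intro k hk
    have h1 := congrArg (MvPolynomial.aeval y) (MvPolynomial.mul_esymm_eq_sum (Fin d) ℂ k)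
    simp only [map_mul, map_natCast, map_pow, map_neg, map_one, map_sum] at h1
    rw [Finset.mem_Icc] at hk
    rw [Finset.sum_eq_zero, mul_zero, mul_eq_zero] at h1
    · exact h1.resolve_left (by exact_mod_cast (by omega : k ≠ 0))
    · intro a ha
      obtain ⟨ha1, ha2⟩ := Finset.mem_filter.1 ha
      rw [Finset.HasAntidiagonal.mem_antidiagonal] at ha1
      have := hy a.2 (Finset.mem_Icc.2 (by omega))
      simp [MvPolynomial.psum, this]
  funext j
  have h := prod_sub_eq_sum_esymm (K := ℂ) y (y j)
  rw [Finset.prod_eq_zero (Finset.mem_univ j) (sub_self _), Finset.sum_range_succ',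
    Finset.sum_eq_zero] at h
  · have h' : y j ^ d = 0 := by simpa using h.symm
    exact pow_eq_zero_iff (Nat.pos_iff_ne_zero.1 (Fin.pos j)) |>.1 h'
  · intro k hk
    rw [he (k + 1) (by simpa [Nat.succ_le_iff] using hk)]
    simp

/-- The power sums of order `d, 2 * d, …, d * d` have no common zero on the unit sphere, which is
compact. -/
theorem exists_le_sum_norm_psum (d : ℕ) :
    ∃ c : ℝ, 0 < c ∧ ∀ x : Fin d → ℂ, ‖x‖ = 1 →
      c ≤ ∑ i ∈ Finset.Icc 1 d, ‖∑ j, x j ^ (d * i)‖ := by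
  set f : (Fin d → ℂ) → ℝ := fun x => ∑ i ∈ Finset.Icc 1 d, ‖∑ j, x j ^ (d * i)‖ with hf
  have hcont : Continuous f := by fun_prop
  rcases (Metric.sphere (0 : Fin d → ℂ) 1).eq_empty_or_nonempty with h0 | h0
  · refine ⟨1, one_pos, fun x hx => ?_⟩
    have : x ∈ Metric.sphere (0 : Fin d → ℂ) 1 := by simpa using hx
    simp [h0] at this
  obtain ⟨x₀, hx₀, hmin⟩ := (isCompact_sphere (0 : Fin d → ℂ) 1).exists_isMinOn h0
    hcont.continuousOn
  refine ⟨f x₀, ?_, fun x hx => hmin (by simpa using hx)⟩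
  refine lt_of_le_of_ne (Finset.sum_nonneg fun _ _ => norm_nonneg _) fun h => ?_
  have hz : (fun j => x₀ j ^ d) = 0 := by
    refine eq_zero_of_psum_eq_zero _ fun i hi => ?_
    have := (Finset.sum_eq_zero_iff_of_nonneg (fun _ _ => norm_nonneg _)).1 h.symm i hi
    simpa [pow_mul] using this
  have : x₀ = 0 := by
    funext j
    exact pow_eq_zero_iff (Nat.pos_iff_ne_zero.1 (Fin.pos j)) |>.1 (congrFun hz j)
  simp [this] at hx₀

/-- Power sums of order `d * i` of size `R ^ (d * i + D)` force the numbers themselves to have size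
`R ^ (1 + D / d)`. -/
theorem exists_norm_pow_le_of_psum_le {d : ℕ} (hd : 0 < d) (D : ℕ) {C : ℝ} (hC : 0 ≤ C) :
    ∃ C' : ℝ, 0 ≤ C' ∧ ∀ (x : Fin d → ℂ) (R : ℝ), 1 ≤ R →
      (∀ i ∈ Finset.Icc 1 d, ‖∑ j, x j ^ (d * i)‖ ≤ C * R ^ (d * i + D)) →
      ‖x‖ ^ d ≤ C' * R ^ (d + D) := by
  obtain ⟨c, hc, hcx⟩ := exists_le_sum_norm_psum d
  refine ⟨1 + d * C / c, by positivity, fun x R hR hx => ?_⟩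
  have hR0 : 0 < R := by linarith
  have hRp : 0 < R ^ (d + D) := by positivity
  rcases le_or_gt ‖x‖ R with h | h
  · calc ‖x‖ ^ d ≤ R ^ d := by gcongr
      _ ≤ R ^ (d + D) := pow_le_pow_right₀ hR (by omega)
      _ ≤ _ := by
        have : 0 ≤ d * C / c * R ^ (d + D) := by positivity
        linarith
  have hX : 0 < ‖x‖ := by linarith
  have h1 := hcx (((‖x‖⁻¹ : ℝ) : ℂ) • x) (by
    rw [norm_smul]; simp [hX.ne'])
  have h2 : ∀ i ∈ Finset.Icc 1 d, ‖∑ j, ((((‖x‖⁻¹ : ℝ) : ℂ) • x) j) ^ (d * i)‖ ≤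
      C * R ^ (d + D) / ‖x‖ ^ d := by
    intro i hi
    have h3 := hx i hi
    rw [Finset.mem_Icc] at hi
    have h4 : ∑ j, ((((‖x‖⁻¹ : ℝ) : ℂ) • x) j) ^ (d * i) =
        ((‖x‖⁻¹ : ℝ) : ℂ) ^ (d * i) * ∑ j, x j ^ (d * i) := by
      rw [Finset.mul_sum]
      exact Finset.sum_congr rfl fun j _ => by simp [mul_pow]
    rw [h4, norm_mul, norm_pow, Complex.norm_real, Real.norm_of_nonneg (by positivity), inv_pow,
      le_div_iff₀ (by positivity)]
    have h5 : d * i = d + d * (i - 1) := by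
      obtain ⟨k, rfl⟩ : ∃ k, i = k + 1 := ⟨i - 1, by omega⟩
      simp; ring
    have h6 : R ^ (d * (i - 1)) ≤ ‖x‖ ^ (d * (i - 1)) := by gcongr
    calc (‖x‖ ^ (d * i))⁻¹ * ‖∑ j, x j ^ (d * i)‖ * ‖x‖ ^ d
        ≤ (‖x‖ ^ (d * i))⁻¹ * (C * R ^ (d * i + D)) * ‖x‖ ^ d := by gcongr
      _ = C * R ^ (d + D) * (R ^ (d * (i - 1)) * (‖x‖ ^ (d * (i - 1)))⁻¹) := by
        rw [h5, pow_add, pow_add R (d + _), pow_add R d, pow_add R d]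
        field_simp
      _ ≤ C * R ^ (d + D) * 1 := by
        gcongr
        exact mul_inv_le_one_of_le₀ h6 (by positivity)
      _ = _ := mul_one _
  have h3 := h1.trans (Finset.sum_le_sum h2)
  rw [Finset.sum_const, Nat.card_Icc, nsmul_eq_mul, Nat.add_sub_cancel, ← mul_div_assoc,
    le_div_iff₀ (by positivity)] at h3
  have h4 : ‖x‖ ^ d ≤ d * C / c * R ^ (d + D) := by
    rw [div_mul_eq_mul_div, le_div_iff₀ hc]
    linarith
  linarith

open Polynomial in
/-- Let the power sums of order `l` of `d` functions be polynomials of degree at most `l + D`, for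
every `l > 0`. Then `∏ j, (c * t - u j t)`, which a priori is a polynomial in `t` of degree about
`d * (D + 1)`, has degree at most `d + D`. -/
theorem exists_polynomial_prod_sub_eq {d D : ℕ} {s : Set ℂ} (hs : s.Infinite)
    (u : Fin d → ℂ → ℂ) (S : ℕ → ℂ[X]) (hdeg : ∀ l, 0 < l → (S l).natDegree ≤ l + D)
    (hS : ∀ l, 0 < l → ∀ t ∈ s, ∑ j, u j t ^ l = (S l).eval t) (c : ℂ) :
    ∃ G : ℂ[X], G.natDegree ≤ d + D ∧ ∀ t ∈ s, ∏ j, (c * t - u j t) = G.eval t := by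
  rcases Nat.eq_zero_or_pos d with rfl | hd
  · exact ⟨1, by simp, by simp⟩
  let φ : ℂ[X] →ₐ[ℂ] (s → ℂ) := aeval (fun t : s => (t : ℂ))
  have hφ : ∀ (B : ℂ[X]) (t : s), φ B t = B.eval (t : ℂ) := by
    intro B t
    rw [← coe_aeval_eq_eval, ← Pi.evalAlgHom_apply ℂ (fun _ : s => ℂ) t (φ B), ← AlgHom.comp_apply]
    congr 1
    ext
    simp [φ]
  have hinj : Function.Injective φ := by
    intro B B' h
    refine eq_of_infinite_eval_eq B B' (hs.mono fun t ht => ?_)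
    have := congrFun h ⟨t, ht⟩
    rwa [hφ, hφ] at this
  let v : Fin d → s → ℂ := fun j t => u j t
  have hpsum : ∀ l, 0 < l → φ (S l) = ∑ j, v j ^ l := by
    intro l hl
    funext t
    rw [hφ, ← hS l hl t t.2]
    simp [v]
  have hA : ∀ k, ∃ A : ℂ[X],
      φ A = MvPolynomial.aeval v (MvPolynomial.esymm (Fin d) ℂ k) := fun k =>
    aeval_esymm_mem φ.range v (fun l hl => ⟨S l, hpsum l hl⟩) k
  choose A hA using hA
  have hA0 : A 0 = 1 := hinj (by rw [hA]; simp)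
  -- Numbers with the elementary symmetric functions `A k` evaluated at an arbitrary point.
  have hx : ∀ z : ℂ, ∃ x : Fin d → ℂ, ∀ k ≤ d,
      MvPolynomial.aeval x (MvPolynomial.esymm (Fin d) ℂ k) = (A k).eval z := fun z =>
    exists_aeval_esymm_eq (fun k => (A k).eval z) (by simp [hA0])
  choose x hx using hx
  have hxpsum : ∀ z l, 0 < l → ∑ j, x z j ^ l = (S l).eval z := by
    intro z l hl
    obtain ⟨g, hg⟩ := MvPolynomial.esymmAlgHom_surjective (σ := Fin d) (n := d) ℂ (by simp)
      ⟨MvPolynomial.psum (Fin d) ℂ l, MvPolynomial.psum_isSymmetric (Fin d) ℂ l⟩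
    have hg' : MvPolynomial.aeval (fun i : Fin d => MvPolynomial.esymm (Fin d) ℂ (i + 1)) g =
        MvPolynomial.psum (Fin d) ℂ l := by
      rw [← MvPolynomial.esymmAlgHom_apply, hg]
    have hcomp : ∀ {B : Type} [CommRing B] [Algebra ℂ B] (y : Fin d → B),
        MvPolynomial.aeval
          (fun i : Fin d => MvPolynomial.aeval y (MvPolynomial.esymm (Fin d) ℂ (i + 1))) g =
          ∑ j, y j ^ l := by
      intro B _ _ y
      have := congrArg (MvPolynomial.aeval y) hg'
      rw [MvPolynomial.comp_aeval_apply] at this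
      rw [this]
      simp [MvPolynomial.psum]
    have h1 : S l = MvPolynomial.aeval (fun i : Fin d => A (i + 1)) g := by
      apply hinj
      rw [hpsum l hl, MvPolynomial.comp_aeval_apply]
      simp only [hA]
      exact (hcomp v).symm
    rw [← hcomp (x z), h1, ← coe_aeval_eq_eval, MvPolynomial.comp_aeval_apply]
    congr 2
    funext i
    rw [hx z _ i.2, coe_aeval_eq_eval]
  set G : ℂ[X] := ∑ k ∈ Finset.range (d + 1), (-1) ^ k * A k * (C c * X) ^ (d - k) with hG
  refine ⟨G, ?_, ?_⟩
  · have hGx : ∀ z, G.eval z = ∏ j, (c * z - x z j) := by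
      intro z
      rw [prod_sub_eq_sum_esymm (K := ℂ), hG, eval_finsetSum]
      refine Finset.sum_congr rfl fun k hk => ?_
      rw [hx z k (by simpa [Nat.lt_succ_iff] using hk)]
      simp
    have hB : ∀ l, ∃ B : ℝ, 0 ≤ B ∧ (0 < l → ∀ z : ℂ,
        ‖(S l).eval z‖ ≤ B * max 1 ‖z‖ ^ (l + D)) := by
      intro l
      rcases Nat.eq_zero_or_pos l with rfl | hl
      · exact ⟨0, le_rfl, by simp⟩
      · obtain ⟨B, hB0, hB⟩ := exists_norm_eval_le (hdeg l hl)
        exact ⟨B, hB0, fun _ => hB⟩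
    choose B hB0 hB using hB
    set B' := ∑ i ∈ Finset.Icc 1 d, B (d * i)
    obtain ⟨C', hC'0, hC'⟩ := exists_norm_pow_le_of_psum_le hd D (C := B')
      (Finset.sum_nonneg fun _ _ => hB0 _)
    refine natDegree_le_of_norm_eval_le (C := 2 ^ d * (‖c‖ ^ d + C')) fun z => ?_
    set R := max 1 ‖z‖ with hR
    have hR1 : 1 ≤ R := le_max_left _ _
    have hxz : ‖x z‖ ^ d ≤ C' * R ^ (d + D) := by
      refine hC' (x z) R hR1 fun i hi => ?_
      have hi0 : 0 < d * i := Nat.mul_pos hd (Finset.mem_Icc.1 hi).1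
      rw [hxpsum z _ hi0]
      refine (hB _ hi0 z).trans ?_
      gcongr
      exact Finset.single_le_sum (f := fun i => B (d * i)) (fun _ _ => hB0 _) hi
    have h1 : ‖G.eval z‖ ≤ (‖c‖ * R + ‖x z‖) ^ d := by
      rw [hGx, norm_prod]
      refine (Finset.prod_le_prod (g := fun _ => ‖c‖ * R + ‖x z‖) (fun _ _ => norm_nonneg _)
        fun j _ => ?_).trans (by simp)
      refine (norm_sub_le _ _).trans ?_
      rw [norm_mul]
      gcongr
      · exact le_max_right _ _
      · exact norm_le_pi_norm _ j
    have h2 : (‖c‖ * R + ‖x z‖) ^ d ≤ 2 ^ d * ((‖c‖ * R) ^ d + ‖x z‖ ^ d) := by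
      refine (add_pow_le (by positivity) (by positivity) d).trans ?_
      gcongr
      · norm_num
      · omega
    have h3 : (‖c‖ * R) ^ d ≤ ‖c‖ ^ d * R ^ (d + D) := by
      rw [mul_pow]
      gcongr
      omega
    calc ‖G.eval z‖ ≤ 2 ^ d * (‖c‖ ^ d * R ^ (d + D) + C' * R ^ (d + D)) := by
          refine h1.trans (h2.trans ?_)
          gcongr
      _ = _ := by ring
  · intro t ht
    have h1 := congrFun (prod_sub_eq_sum_esymm (K := ℂ) v (φ (C c * X))) ⟨t, ht⟩
    simp only [← hA, Finset.prod_apply, Finset.sum_apply, Pi.sub_apply, Pi.mul_apply, Pi.pow_apply,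
      Pi.neg_apply, Pi.one_apply, hφ, eval_mul, eval_C, eval_X, v] at h1
    rw [h1, hG, eval_finsetSum]
    simp

end AffineWood

/-! ### Polynomials in several variables -/

namespace AffineWood

open Polynomial in
/-- A function that is analytic at the origin of `ℂⁿ` and whose restriction to each line through
the origin is a polynomial of degree at most `N` is itself a polynomial of degree at most `N`. -/
theorem exists_mvPolynomial_of_lines {n N : ℕ} {f : (Fin n → ℂ) → ℂ} (hf : AnalyticAt ℂ f 0)
    (hline : ∀ ξ : Fin n → ℂ, ∃ G : ℂ[X], G.natDegree ≤ N ∧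
      ∀ᶠ t : ℂ in 𝓝 0, f (t • ξ) = G.eval t) :
    ∃ F : MvPolynomial (Fin n) ℂ, F.totalDegree ≤ N ∧
      ∀ ξ : Fin n → ℂ, ∀ᶠ t : ℂ in 𝓝 0, f (t • ξ) = MvPolynomial.eval (t • ξ) F := by
  obtain ⟨p, r, hp⟩ := hf
  -- The homogeneous parts of the Taylor series are the coefficients along lines.
  have hcoeff : ∀ (ξ : Fin n → ℂ) (G : ℂ[X]), (∀ᶠ t : ℂ in 𝓝 0, f (t • ξ) = G.eval t) →
      ∀ k, p k (fun _ => ξ) = G.coeff k := by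
    intro ξ G hG k
    have h1 : HasFPowerSeriesAt (fun t : ℂ => f (t • ξ))
        (FormalMultilinearSeries.ofScalars ℂ fun k => p k fun _ => ξ) 0 := by
      rw [hasFPowerSeriesAt_iff]
      have hc : Tendsto (fun t : ℂ => t • ξ) (𝓝 0) (𝓝 0) := by
        have : Continuous fun t : ℂ => t • ξ := by fun_prop
        simpa using this.tendsto 0
      filter_upwards [hc.eventually (Metric.eball_mem_nhds 0 hp.r_pos)] with t ht
      have := hp.hasSum ht
      rw [zero_add] at this
      rw [zero_add]
      have hterm : (fun k => p k fun _ => t • ξ) = fun k => t ^ k •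
          (FormalMultilinearSeries.ofScalars ℂ fun k => p k fun _ => ξ).coeff k := by
        funext k
        rw [FormalMultilinearSeries.coeff_ofScalars]
        simpa using (p k).map_smul_univ (fun _ => t) fun _ => ξ
      rwa [← hterm]
    have h2 : HasFPowerSeriesAt (fun t : ℂ => f (t • ξ))
        (FormalMultilinearSeries.ofScalars ℂ fun k => G.coeff k) 0 := by
      rw [hasFPowerSeriesAt_iff]
      filter_upwards [hG] with t ht
      rw [zero_add, ht, eval_eq_sum_range]
      simp only [FormalMultilinearSeries.coeff_ofScalars, smul_eq_mul]
      have := hasSum_sum_of_ne_finset_zero (f := fun k => t ^ k * G.coeff k)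
        (L := SummationFilter.unconditional ℕ) (s := Finset.range (G.natDegree + 1)) fun k hk => by
          rw [coeff_eq_zero_of_natDegree_lt (by simpa using hk), mul_zero]
      simpa only [mul_comm] using this
    have h3 := congrArg (fun q => q.coeff k) (h1.eq_formalMultilinearSeries h2)
    simpa using h3
  set F : MvPolynomial (Fin n) ℂ := ∑ k ∈ Finset.range (N + 1), ∑ e : Fin k → Fin n,
    MvPolynomial.C (p k fun i => Pi.single (e i) 1) * ∏ i, MvPolynomial.X (e i) with hF
  have hFeval : ∀ ξ, MvPolynomial.eval ξ F = ∑ k ∈ Finset.range (N + 1), p k fun _ => ξ := by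
    intro ξ
    rw [hF, map_sum]
    refine Finset.sum_congr rfl fun k _ => ?_
    have h1 : (fun _ : Fin k => ξ) = fun _ => ∑ a, ξ a • (Pi.single a 1 : Fin n → ℂ) := by
      funext i
      exact pi_eq_sum_univ' ξ
    rw [h1, map_sum, ← ContinuousMultilinearMap.coe_coe, MultilinearMap.map_sum]
    refine Finset.sum_congr rfl fun e _ => ?_
    rw [MultilinearMap.map_smul_univ]
    simp [mul_comm]
  refine ⟨F, ?_, fun ξ => ?_⟩
  · refine MvPolynomial.totalDegree_finsetSum_le fun k hk => ?_
    refine MvPolynomial.totalDegree_finsetSum_le fun e _ => ?_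
    refine (MvPolynomial.totalDegree_mul _ _).trans ?_
    rw [MvPolynomial.totalDegree_C, zero_add]
    refine (MvPolynomial.totalDegree_finsetProd _ _).trans ?_
    simp only [MvPolynomial.totalDegree_X, Finset.sum_const, Finset.card_univ, Fintype.card_fin,
      smul_eq_mul, mul_one]
    simpa [Nat.lt_succ_iff] using hk
  · obtain ⟨G, hGdeg, hG⟩ := hline ξ
    filter_upwards [hG] with t ht
    rw [ht, hFeval, eval_eq_sum_range' (Nat.lt_succ_of_le hGdeg)]
    refine Finset.sum_congr rfl fun k _ => ?_
    rw [← hcoeff ξ G hG]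
    have := (p k).map_smul_univ (fun _ => t) fun _ => ξ
    rw [this]
    simp [mul_comm]

/-- In a space `W` of polynomials of bounded degree, a polynomial is recovered linearly from its
values at finitely many points, which can be taken close to the origin. -/
theorem exists_interpolation {n N : ℕ} (W : Submodule ℂ (MvPolynomial (Fin n) ℂ))
    (hW : ∀ F ∈ W, F.totalDegree ≤ N) {U : Set (Fin n → ℂ)} (hU : U ∈ 𝓝 0) :
    ∃ (M : ℕ) (x : Fin M → Fin n → ℂ) (P : Fin M → MvPolynomial (Fin n) ℂ),
      (∀ i, x i ∈ U) ∧ (∀ i, P i ∈ W) ∧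
      ∀ F ∈ W, F = ∑ i, MvPolynomial.eval (x i) F • P i := by
  obtain ⟨r, hr, hrU⟩ := Metric.mem_nhds_iff.1 hU
  have hinf : (Metric.ball (0 : ℂ) r).Infinite :=
    infinite_of_mem_nhds 0 (Metric.ball_mem_nhds 0 hr)
  obtain ⟨T, hT, hTcard⟩ := hinf.exists_subset_card_eq (N + 1)
  set S : Finset (Fin n → ℂ) := Fintype.piFinset fun _ => T with hS
  set x : Fin S.card → Fin n → ℂ := fun i => S.equivFin.symm i with hx
  let ev : W →ₗ[ℂ] Fin S.card → ℂ :=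
    { toFun := fun F i => MvPolynomial.eval (x i) (F : MvPolynomial (Fin n) ℂ)
      map_add' := by intro F G; funext i; simp
      map_smul' := by intro c F; funext i; simp }
  have hker : LinearMap.ker ev = ⊥ := by
    rw [LinearMap.ker_eq_bot']
    intro F hF
    refine Subtype.ext (MvPolynomial.eq_zero_of_eval_zero_at_prod_finset _ (fun _ => T)
      (fun i => ?_) fun y hy => ?_)
    · rw [hTcard, Nat.lt_succ_iff]
      exact (MvPolynomial.degreeOf_le_totalDegree _ _).trans (hW _ F.2)
    · have hyS : y ∈ S := Fintype.mem_piFinset.2 hy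
      have := congrFun hF (S.equivFin ⟨y, hyS⟩)
      simpa [ev, hx] using this
  obtain ⟨g, hg⟩ := ev.exists_leftInverse_of_injective hker
  refine ⟨S.card, x, fun i => (g (Pi.single i 1) : W), fun i => hrU ?_, fun i => (g _).2,
    fun F hF => ?_⟩
  · have hi : x i ∈ S := (S.equivFin.symm i).2
    rw [hS, Fintype.mem_piFinset] at hi
    rw [mem_ball_zero_iff, pi_norm_lt_iff hr]
    exact fun a => by simpa using hT (hi a)
  · have h1 := LinearMap.congr_fun hg ⟨F, hF⟩
    rw [LinearMap.comp_apply, pi_eq_sum_univ' (ev ⟨F, hF⟩), map_sum] at h1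
    have h2 := congrArg (Subtype.val) h1
    simp only [LinearMap.id_apply, map_smul] at h2
    conv_lhs => rw [← h2]
    simp [ev]

end AffineWood

/-! ### Analytic dependence of the intersection points -/

namespace AffineWood

variable {q m : ℕ}

/-- The last `m` coordinates of a point of `ℂ^(q + m)`. -/
def tail (ζ : Fin (q + m) → ℂ) : Fin m → ℂ := fun r => ζ (Fin.natAdd q r)

/-- The parameter `β` of the member of the parallel family `L_{α,β}`, with `α` fixed, that contains
`ζ`. -/
def offset (α : Fin q → Fin m → ℂ) (ζ : Fin (q + m) → ℂ) : Fin q → ℂ :=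
  fun k => ζ (Fin.castAdd m k) - ∑ r, α k r * ζ (Fin.natAdd q r)

/-- The point of `L_{α,β}` with last coordinates `w`. -/
def affPoint (α : Fin q → Fin m → ℂ) (β : Fin q → ℂ) (w : Fin m → ℂ) : Fin (q + m) → ℂ :=
  Fin.append (fun k => ∑ r, α k r * w r + β k) w

@[simp] theorem tail_affPoint (α : Fin q → Fin m → ℂ) (β : Fin q → ℂ) (w : Fin m → ℂ) :
    tail (affPoint α β w) = w := by
  funext r; simp [tail, affPoint]

theorem affPoint_mem (α : Fin q → Fin m → ℂ) (β : Fin q → ℂ) (w : Fin m → ℂ) :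
    affPoint α β w ∈ affL α β := by
  intro k; simp [affPoint]

theorem mem_affL_iff_offset {α : Fin q → Fin m → ℂ} {β : Fin q → ℂ} {ζ : Fin (q + m) → ℂ} :
    ζ ∈ affL α β ↔ offset α ζ = β := by
  constructor
  · intro h
    funext k
    simp [offset, h k]
  · rintro rfl k
    simp [offset]

theorem eq_affPoint {α : Fin q → Fin m → ℂ} {β : Fin q → ℂ} {ζ : Fin (q + m) → ℂ}
    (h : ζ ∈ affL α β) : ζ = affPoint α β (tail ζ) := by
  funext i
  refine Fin.addCases (fun k => ?_) (fun r => ?_) i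
  · simp [affPoint, tail, h k]
  · simp [affPoint, tail]

theorem contDiff_affPoint {N : WithTop ℕ∞} :
    ContDiff ℂ N (fun y : ((Fin q → Fin m → ℂ) × (Fin q → ℂ)) × (Fin m → ℂ) =>
      affPoint y.1.1 y.1.2 y.2) := by
  refine contDiff_pi.2 fun i => ?_
  refine Fin.addCases (fun k => ?_) (fun r => ?_) i
  · simp only [affPoint, Fin.append_left]
    fun_prop
  · simp only [affPoint, Fin.append_right]
    fun_prop

/-- The last coordinates of the intersection point of `γ` with `L_{α,β}` depend analytically on
`(α, β)`, by the implicit function theorem: transversality is the invertibility of the partial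
differential, and uniqueness of the intersection point identifies it with the implicit function. -/
theorem analyticAt_tail {γ : Set (Fin (q + m) → ℂ)}
    {p : (Fin q → Fin m → ℂ) → (Fin q → ℂ) → (Fin (q + m) → ℂ)}
    (hp : ∀ᶠ x : (Fin q → Fin m → ℂ) × (Fin q → ℂ) in 𝓝 (0, 0), affL x.1 x.2 ∩ γ = {p x.1 x.2})
    (ht : IsTransversalAt m γ (dirL 0) (p 0 0)) :
    AnalyticAt ℂ (fun x : (Fin q → Fin m → ℂ) × (Fin q → ℂ) => tail (p x.1 x.2)) (0, 0) := by
  obtain ⟨Φ, ⟨hΦ, hsurj, hloc⟩, htop⟩ := ht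
  have hmem : ∀ x : (Fin q → Fin m → ℂ) × (Fin q → ℂ), affL x.1 x.2 ∩ γ = {p x.1 x.2} →
      p x.1 x.2 ∈ affL x.1 x.2 ∩ γ := fun x hx => hx ▸ rfl
  obtain ⟨h0L, h0γ⟩ := hmem _ hp.self_of_nhds
  set w₀ := tail (p 0 0) with hw₀
  have hpt : affPoint 0 0 w₀ = p 0 0 := (eq_affPoint h0L).symm
  set A : ((Fin q → Fin m → ℂ) × (Fin q → ℂ)) × (Fin m → ℂ) → Fin (q + m) → ℂ :=
    fun y => affPoint y.1.1 y.1.2 y.2 with hA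
  set o : ((Fin q → Fin m → ℂ) × (Fin q → ℂ)) × (Fin m → ℂ) := ((0, 0), w₀) with ho
  have hAo : A o = p 0 0 := hpt
  have hcd : ContDiffAt ℂ ⊤ (Φ ∘ A) o :=
    ContDiffAt.comp o (by rw [hAo]; exact hΦ.contDiffAt) contDiff_affPoint.contDiffAt
  -- The inclusion of the last coordinates, which is `affPoint 0 0`.
  let ι : (Fin m → ℂ) →L[ℂ] (Fin (q + m) → ℂ) := LinearMap.toContinuousLinearMap
    { toFun := affPoint (0 : Fin q → Fin m → ℂ) 0
      map_add' := by
        intro a b; funext i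
        refine Fin.addCases (fun k => ?_) (fun r => ?_) i <;> simp [affPoint]
      map_smul' := by
        intro a b; funext i
        refine Fin.addCases (fun k => ?_) (fun r => ?_) i <;> simp [affPoint] }
  have hι : ∀ w, ι w = affPoint 0 0 w := fun w => rfl
  have hpartial : fderiv ℂ (Φ ∘ A) o ∘L .inr ℂ _ _ = fderiv ℂ Φ (p 0 0) ∘L ι := by
    have h1 : HasFDerivAt (fun w => (Φ ∘ A) (o.1, w)) (fderiv ℂ (Φ ∘ A) o ∘L .inr ℂ _ _) w₀ :=
      HasFDerivAt.comp (f := fun w : Fin m → ℂ => (o.1, w)) w₀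
        ((hcd.differentiableAt (by simp)).hasFDerivAt) (hasFDerivAt_prodMk_right o.1 w₀)
    have h2 : HasFDerivAt (fun w => Φ (ι w)) (fderiv ℂ Φ (p 0 0) ∘L ι) w₀ := by
      refine HasFDerivAt.comp (f := ι) w₀ ?_ ι.hasFDerivAt
      rw [hι, hpt]
      exact hΦ.differentiableAt.hasFDerivAt
    exact h1.unique h2
  have hs : Function.Surjective (fderiv ℂ Φ (p 0 0) ∘L ι) := by
    intro v
    obtain ⟨a, rfl⟩ := hsurj v
    have ha : a ∈ LinearMap.ker (fderiv ℂ Φ (p 0 0)).toLinearMap ⊔ dirL 0 := htop ▸ trivial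
    obtain ⟨k, hk, z, hz, rfl⟩ := Submodule.mem_sup.1 ha
    refine ⟨tail z, ?_⟩
    have hz' : affPoint 0 0 (tail z) = z := (eq_affPoint hz).symm
    have hk' : fderiv ℂ Φ (p 0 0) k = 0 := hk
    rw [ContinuousLinearMap.comp_apply, hι, hz', map_add, hk', zero_add]
  have hinv : (fderiv ℂ (Φ ∘ A) o ∘L .inr ℂ _ _).IsInvertible := by
    rw [hpartial]
    have hi : Function.Injective (fderiv ℂ Φ (p 0 0) ∘L ι) :=
      (LinearMap.injective_iff_surjective
        (f := (fderiv ℂ Φ (p 0 0) ∘L ι : (Fin m → ℂ) →L[ℂ] (Fin m → ℂ)).toLinearMap)).2 hs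
    exact ⟨ContinuousLinearEquiv.ofBijective (fderiv ℂ Φ (p 0 0) ∘L ι)
      (LinearMap.ker_eq_bot.2 hi) (LinearMap.range_eq_top.2 hs),
      ContinuousLinearEquiv.coe_ofBijective _ _ _⟩
  have hψ := (hcd.contDiffAt_implicitFunction (by simp) hinv).analyticAt
  have hψ0 : hcd.implicitFunction (by simp) hinv o.1 = w₀ :=
    hcd.implicitFunction_apply_self (by simp) hinv
  have hψeq := hcd.eventually_apply_implicitFunction (by simp) hinv
  refine hψ.congr ?_
  have hcont : Tendsto (fun x => A (x, hcd.implicitFunction (by simp) hinv x)) (𝓝 o.1)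
      (𝓝 (p 0 0)) := by
    have h1 : ContinuousAt (fun x => A (x, hcd.implicitFunction (by simp) hinv x)) o.1 :=
      ContinuousAt.comp (g := A) (contDiff_affPoint (N := 0)).continuous.continuousAt
        (continuousAt_id.prodMk hψ.continuousAt)
    have h2 := h1.tendsto
    rwa [hψ0, show A (o.1, w₀) = p 0 0 from hAo] at h2
  filter_upwards [hψeq, hcont.eventually hloc, hp] with x hx1 hx2 hx3
  have h0 : (Φ ∘ A) o = 0 := by
    rw [Function.comp_apply, hAo]
    exact hloc.self_of_nhds.1 h0γ
  have h1 : A (x, hcd.implicitFunction (by simp) hinv x) ∈ affL x.1 x.2 ∩ γ :=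
    ⟨affPoint_mem _ _ _, hx2.2 (hx1.trans h0)⟩
  rw [hx3, Set.mem_singleton_iff] at h1
  rw [← h1]
  exact (tail_affPoint _ _ _).symm

end AffineWood

/-! ### The Burgers equation for the branches and its consequences -/

namespace AffineWood

variable {q m : ℕ}

/-- Let `u j` be solutions of the inviscid Burgers equation `∂ₛ u = u ∂ₜ u` on a product of discs,
whose sum is a polynomial in `t` of degree at most `D + 1`. Then the power sums of order `l` are
polynomials in `t` of degree at most `l + D`: since `∂ₜ (u ^ (l + 1)) / (l + 1) = ∂ₛ (u ^ l) / l`,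
passing from `l` to `l + 1` is one integration in `t`. -/
theorem exists_psum_eq_of_burgers {d D : ℕ} {ρ R : ℝ} (hR : 0 < R) (u v : Fin d → ℂ → ℂ → ℂ)
    (hus : ∀ j, ∀ s ∈ Metric.ball (0 : ℂ) ρ, ∀ t ∈ Metric.ball (0 : ℂ) R,
      HasDerivAt (fun s => u j s t) (u j s t * v j s t) s)
    (hut : ∀ j, ∀ s ∈ Metric.ball (0 : ℂ) ρ, ∀ t ∈ Metric.ball (0 : ℂ) R,
      HasDerivAt (fun t => u j s t) (v j s t) t)
    (hsum : ∃ a : ℕ → ℂ → ℂ, (∀ i, DifferentiableOn ℂ (a i) (Metric.ball 0 ρ)) ∧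
      ∀ s ∈ Metric.ball (0 : ℂ) ρ, ∀ t ∈ Metric.ball (0 : ℂ) R,
        ∑ j, u j s t = ∑ i ∈ Finset.range (1 + D + 1), a i s * t ^ i)
    {l : ℕ} (hl : 1 ≤ l) :
    ∃ a : ℕ → ℂ → ℂ, (∀ i, DifferentiableOn ℂ (a i) (Metric.ball 0 ρ)) ∧
      ∀ s ∈ Metric.ball (0 : ℂ) ρ, ∀ t ∈ Metric.ball (0 : ℂ) R,
        ∑ j, u j s t ^ l = ∑ i ∈ Finset.range (l + D + 1), a i s * t ^ i := by
  induction l, hl using Nat.le_induction with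
  | base => simpa using hsum
  | succ l hl ih =>
    obtain ⟨a, ha, hsa⟩ := ih
    have hl0 : (l : ℂ) ≠ 0 := by exact_mod_cast (by omega : l ≠ 0)
    have h0R : (0 : ℂ) ∈ Metric.ball (0 : ℂ) R := Metric.mem_ball_self hR
    have ha' : ∀ i, ∀ s ∈ Metric.ball (0 : ℂ) ρ, HasDerivAt (a i) (deriv (a i) s) s :=
      fun i s hs => ((ha i).differentiableAt (Metric.isOpen_ball.mem_nhds hs)).hasDerivAt
    have hkey : ∀ s ∈ Metric.ball (0 : ℂ) ρ, ∀ t ∈ Metric.ball (0 : ℂ) R,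
        (l : ℂ) * ∑ j, u j s t ^ l * v j s t =
          ∑ i ∈ Finset.range (l + D + 1), deriv (a i) s * t ^ i := by
      intro s hs t ht
      have h1 : HasDerivAt (fun s => ∑ j, u j s t ^ l)
          (∑ j, (l : ℂ) * u j s t ^ (l - 1) * (u j s t * v j s t)) s :=
        HasDerivAt.fun_sum fun j _ => (hus j s hs t ht).pow l
      have h2 : HasDerivAt (fun s => ∑ i ∈ Finset.range (l + D + 1), a i s * t ^ i)
          (∑ i ∈ Finset.range (l + D + 1), deriv (a i) s * t ^ i) s :=
        HasDerivAt.fun_sum fun i _ => (ha' i s hs).mul_const _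
      have h3 : (fun s => ∑ j, u j s t ^ l) =ᶠ[𝓝 s]
          fun s => ∑ i ∈ Finset.range (l + D + 1), a i s * t ^ i := by
        filter_upwards [Metric.isOpen_ball.mem_nhds hs] with s' hs'
        exact hsa s' hs' t ht
      rw [← (h1.congr_of_eventuallyEq h3.symm).unique h2, Finset.mul_sum]
      refine Finset.sum_congr rfl fun j _ => ?_
      obtain ⟨k, rfl⟩ : ∃ k, l = k + 1 := ⟨l - 1, by omega⟩
      simp only [Nat.add_sub_cancel]
      ring
    refine ⟨fun i s => Nat.casesOn i (∑ j, u j s 0 ^ (l + 1)) fun i =>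
      ((l + 1 : ℂ) / l) * deriv (a i) s / (i + 1), fun i => ?_, fun s hs t ht => ?_⟩
    · rcases i with _ | i
      · intro s hs
        exact (HasDerivAt.fun_sum fun j _ =>
          (hus j s hs 0 h0R).pow (l + 1)).differentiableAt.differentiableWithinAt
      · have := (ha i).deriv Metric.isOpen_ball
        fun_prop
    · have h1 : ∀ t ∈ Metric.ball (0 : ℂ) R, HasDerivAt (fun t => ∑ j, u j s t ^ (l + 1))
          (∑ j, ((l + 1 : ℕ) : ℂ) * u j s t ^ l * v j s t) t := fun t ht =>
        HasDerivAt.fun_sum fun j _ => by simpa using (hut j s hs t ht).fun_pow (l + 1)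
      have h2 : ∀ t : ℂ, HasDerivAt (fun t => ∑ i ∈ Finset.range (l + D + 1),
          ((l + 1 : ℂ) / l) * deriv (a i) s / (i + 1) * t ^ (i + 1))
          (∑ i ∈ Finset.range (l + D + 1), ((l + 1 : ℂ) / l) * deriv (a i) s / (i + 1) *
            (((i + 1 : ℕ) : ℂ) * t ^ i)) t := fun t =>
        HasDerivAt.fun_sum fun i _ => by
          simpa using (hasDerivAt_pow (i + 1) t).const_mul
            (((l + 1 : ℂ) / l) * deriv (a i) s / (i + 1))
      have h3 : ∀ t ∈ Metric.ball (0 : ℂ) R,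
          ∑ j, ((l + 1 : ℕ) : ℂ) * u j s t ^ l * v j s t =
          ∑ i ∈ Finset.range (l + D + 1), ((l + 1 : ℂ) / l) * deriv (a i) s / (i + 1) *
            (((i + 1 : ℕ) : ℂ) * t ^ i) := by
        intro t ht
        have h4 := hkey s hs t ht
        calc ∑ j, ((l + 1 : ℕ) : ℂ) * u j s t ^ l * v j s t
            = ((l + 1 : ℂ) / l) * ((l : ℂ) * ∑ j, u j s t ^ l * v j s t) := by
              rw [← mul_assoc, div_mul_cancel₀ _ hl0, Finset.mul_sum]
              exact Finset.sum_congr rfl fun j _ => by push_cast; ring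
          _ = _ := by
              rw [h4, Finset.mul_sum]
              refine Finset.sum_congr rfl fun i _ => ?_
              have : (i + 1 : ℂ) ≠ 0 := by exact_mod_cast Nat.succ_ne_zero i
              push_cast
              field_simp
      have h5 := Metric.isOpen_ball.is_const_of_deriv_eq_zero
        (convex_ball (0 : ℂ) R).isPreconnected
        (fun t ht => ((h1 t ht).sub (h2 t)).differentiableAt.differentiableWithinAt)
        (fun t ht => by
          rw [((h1 t ht).sub (h2 t)).deriv, h3 t ht, sub_self, Pi.zero_apply]) ht h0R
      simp only [Pi.sub_apply] at h5
      rw [show l + 1 + D + 1 = l + D + 1 + 1 by ring, Finset.sum_range_succ']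
      simp only [pow_zero, mul_one]
      have h6 : ∑ i ∈ Finset.range (l + D + 1),
          ((l + 1 : ℂ) / l) * deriv (a i) s / (i + 1) * (0 : ℂ) ^ (i + 1) = 0 :=
        Finset.sum_eq_zero fun i _ => by simp
      rw [h6, sub_zero] at h5
      linear_combination h5

/-- The product of `δ`-balls in the parameter space of the `L_{α,β}`. -/
def paramBall (q m : ℕ) (δ : ℝ) : Set ((Fin q → Fin m → ℂ) × (Fin q → ℂ)) :=
  {x | ‖x.1‖ < δ ∧ ‖x.2‖ < δ}

theorem isOpen_paramBall (δ : ℝ) : IsOpen (paramBall q m δ) :=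
  (isOpen_lt continuous_fst.norm continuous_const).inter
    (isOpen_lt continuous_snd.norm continuous_const)

/-- The last coordinates `w (α, β)` of the intersection point of `L_{α,β}` with one analytic piece,
for `(α, β)` in a ball: an analytic function with the property that `w` takes the same value at
two parameters as soon as the second affine space contains the intersection point of the first. -/
structure IsBranch (δ : ℝ) (w : (Fin q → Fin m → ℂ) × (Fin q → ℂ) → (Fin m → ℂ)) : Prop where
  analyticAt : ∀ x ∈ paramBall q m δ, AnalyticAt ℂ w x
  eq_of_mem : ∀ x ∈ paramBall q m δ, ∀ y ∈ paramBall q m δ,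
    affPoint x.1 x.2 (w x) ∈ affL y.1 y.2 → w y = w x

/-- The rank one matrix `e ⊗ c`. -/
noncomputable def rankOne (e : Fin q → ℂ) (c : (Fin m → ℂ) →L[ℂ] ℂ) : Fin q → Fin m → ℂ :=
  fun k r => e k * c (Pi.single r 1)

theorem sum_rankOne_mul (e : Fin q → ℂ) (c : (Fin m → ℂ) →L[ℂ] ℂ) (w : Fin m → ℂ) (k : Fin q) :
    ∑ r, rankOne e c k r * w r = e k * c w := by
  conv_rhs => rw [pi_eq_sum_univ' w, map_sum, Finset.mul_sum]
  refine Finset.sum_congr rfl fun r _ => ?_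
  simp only [rankOne, map_smul, smul_eq_mul]
  ring

/-- The differential equation satisfied by a branch: moving `α` in the direction `e ⊗ c` and `β` in
the direction `- c w • e` moves the affine space within those through the intersection point. -/
theorem IsBranch.fderiv_rankOne {δ : ℝ} {w : (Fin q → Fin m → ℂ) × (Fin q → ℂ) → (Fin m → ℂ)}
    (hw : IsBranch δ w) {x : (Fin q → Fin m → ℂ) × (Fin q → ℂ)} (hx : x ∈ paramBall q m δ)
    (e : Fin q → ℂ) (c : (Fin m → ℂ) →L[ℂ] ℂ) :
    fderiv ℂ w x (rankOne e c, 0) = c (w x) • fderiv ℂ w x (0, e) := by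
  set v : (Fin q → Fin m → ℂ) × (Fin q → ℂ) := (rankOne e c, -(c (w x) • e)) with hv
  have hline : HasDerivAt (fun s : ℂ => x + s • v) v 0 := by
    simpa using ((hasDerivAt_id (0 : ℂ)).smul_const v).const_add x
  have h1 : HasDerivAt (fun s : ℂ => w (x + s • v)) (fderiv ℂ w x v) 0 := by
    refine HasFDerivAt.comp_hasDerivAt (f := fun s : ℂ => x + s • v) 0 ?_ hline
    simpa using (hw.analyticAt x hx).differentiableAt.hasFDerivAt
  have h2 : (fun s : ℂ => w (x + s • v)) =ᶠ[𝓝 0] fun _ => w x := by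
    have hc : ContinuousAt (fun s : ℂ => x + s • v) 0 := hline.continuousAt
    have hmem : paramBall q m δ ∈ 𝓝 (x + (0 : ℂ) • v) := by
      simpa using (isOpen_paramBall δ).mem_nhds hx
    filter_upwards [hc.tendsto.eventually hmem] with s hs
    refine hw.eq_of_mem x hx _ hs fun k => ?_
    have h3 := sum_rankOne_mul e c (w x) k
    simp only [affPoint, Fin.append_left, Fin.append_right, hv, Prod.fst_add, Prod.snd_add,
      Prod.smul_fst, Prod.smul_snd, Pi.add_apply, Pi.smul_apply, Pi.neg_apply, smul_eq_mul,
      add_mul, Finset.sum_add_distrib, mul_assoc, ← Finset.mul_sum, h3]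
    ring
  have h4 : fderiv ℂ w x v = 0 :=
    h1.unique ((hasDerivAt_const (0 : ℂ) (w x)).congr_of_eventuallyEq h2)
  have h5 : v = (rankOne e c, 0) - c (w x) • ((0, e) : (Fin q → Fin m → ℂ) × (Fin q → ℂ)) := by
    simp [hv]
  rw [h5, map_sub, map_smul] at h4
  exact sub_eq_zero.1 h4

open Polynomial in
/-- Along a line `β = t • e`, with `α` fixed, the product of the `z * t - c (w j)` is a polynomial
in `t` of degree at most `d + D`. -/
theorem exists_polynomial_prod_branch {d D : ℕ} {δ : ℝ}
    {w : Fin d → (Fin q → Fin m → ℂ) × (Fin q → ℂ) → (Fin m → ℂ)} (hw : ∀ j, IsBranch δ (w j))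
    {h : Fin m → (Fin q → ℕ) → (Fin q → Fin m → ℂ) → ℂ}
    (hh : ∀ l, ∀ k ∈ multiIndices q (D + 1), ∀ α : Fin q → Fin m → ℂ, ‖α‖ < δ →
      AnalyticAt ℂ (h l k) α)
    (hsum : ∀ x ∈ paramBall q m δ, ∀ l : Fin m,
      ∑ j, w j x l = ∑ k ∈ multiIndices q (D + 1), h l k x.1 * ∏ i, x.2 i ^ k i)
    {α : Fin q → Fin m → ℂ} (hα : ‖α‖ < δ) (e : Fin q → ℂ) {R : ℝ} (hR : 0 < R)
    (he : ∀ t ∈ Metric.ball (0 : ℂ) R, ‖t • e‖ < δ) (c : (Fin m → ℂ) →L[ℂ] ℂ) (z : ℂ) :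
    ∃ G : ℂ[X], G.natDegree ≤ d + D ∧
      ∀ t ∈ Metric.ball (0 : ℂ) R, ∏ j, (z * t - c (w j (α, t • e))) = G.eval t := by
  set E := rankOne e c with hE
  obtain ⟨ρ, hρ, hρα⟩ : ∃ ρ > 0, ∀ s ∈ Metric.ball (0 : ℂ) ρ, ‖α + s • E‖ < δ := by
    have hc : Continuous fun s : ℂ => ‖α + s • E‖ := by fun_prop
    have := (hc.tendsto 0).eventually_lt_const (u := δ) (by simpa using hα)
    exact Metric.eventually_nhds_iff_ball.1 this
  set x : ℂ → ℂ → (Fin q → Fin m → ℂ) × (Fin q → ℂ) := fun s t => (α + s • E, t • e) with hx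
  have hxmem : ∀ s ∈ Metric.ball (0 : ℂ) ρ, ∀ t ∈ Metric.ball (0 : ℂ) R,
      x s t ∈ paramBall q m δ := fun s hs t ht => ⟨hρα s hs, he t ht⟩
  have hdiff : ∀ j, ∀ s ∈ Metric.ball (0 : ℂ) ρ, ∀ t ∈ Metric.ball (0 : ℂ) R,
      HasFDerivAt (fun y => c (w j y)) (c ∘L fderiv ℂ (w j) (x s t)) (x s t) :=
    fun j s hs t ht => c.hasFDerivAt.comp _
      ((hw j).analyticAt _ (hxmem s hs t ht)).differentiableAt.hasFDerivAt
  have hpsum := fun l (hl : 1 ≤ l) => exists_psum_eq_of_burgers (d := d) (D := D) (ρ := ρ) hR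
    (fun j s t => c (w j (x s t))) (fun j s t => c (fderiv ℂ (w j) (x s t) (0, e)))
    (fun j s hs t ht => by
      have h1 : HasDerivAt (fun s => x s t) (E, (0 : Fin q → ℂ)) s := by
        refine HasDerivAt.prodMk ?_ (hasDerivAt_const s (t • e))
        simpa using ((hasDerivAt_id s).smul_const E).const_add α
      have h2 := (hdiff j s hs t ht).comp_hasDerivAt s h1
      rw [ContinuousLinearMap.comp_apply, (hw j).fderiv_rankOne (hxmem s hs t ht), map_smul] at h2
      exact h2)
    (fun j s hs t ht => by
      have h1 : HasDerivAt (fun t => x s t) ((0 : Fin q → Fin m → ℂ), e) t := by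
        refine HasDerivAt.prodMk (hasDerivAt_const t (α + s • E)) ?_
        simpa using (hasDerivAt_id t).smul_const e
      exact (hdiff j s hs t ht).comp_hasDerivAt t h1)
    (by
      refine ⟨fun i s => ∑ l, c (Pi.single l 1) *
        ∑ k ∈ (multiIndices q (D + 1)).filter (fun k => ∑ a, k a = i),
          h l k (α + s • E) * ∏ a, e a ^ k a, fun i s hs => ?_, fun s hs t ht => ?_⟩
      · refine DifferentiableAt.differentiableWithinAt ?_
        refine DifferentiableAt.fun_sum fun l _ => DifferentiableAt.const_mul ?_ _
        refine DifferentiableAt.fun_sum fun k hk => DifferentiableAt.mul_const ?_ _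
        exact DifferentiableAt.comp (f := fun s : ℂ => α + s • E) s
          (hh l k (Finset.mem_filter.1 hk).1 _ (hρα s hs)).differentiableAt (by fun_prop)
      · have h1 : ∑ j, c (w j (x s t)) = ∑ l, c (Pi.single l 1) * ∑ j, w j (x s t) l := by
          rw [← map_sum]
          conv_lhs => rw [pi_eq_sum_univ' (∑ j, w j (x s t)), map_sum]
          refine Finset.sum_congr rfl fun l _ => ?_
          rw [map_smul, smul_eq_mul, Finset.sum_apply, mul_comm]
        rw [h1]
        simp only [Finset.sum_mul]
        rw [Finset.sum_comm]
        refine Finset.sum_congr rfl fun l _ => ?_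
        simp only [mul_assoc, ← Finset.mul_sum]
        congr 1
        rw [hsum _ (hxmem s hs t ht), ← Finset.sum_fiberwise_of_maps_to
          (s := multiIndices q (D + 1)) (t := Finset.range (1 + D + 1)) (g := fun k => ∑ a, k a)
          fun k hk => by
            have := mem_multiIndices.1 hk
            rw [Finset.mem_range]; omega]
        refine Finset.sum_congr rfl fun i _ => ?_
        rw [Finset.sum_mul]
        refine Finset.sum_congr rfl fun k hk => ?_
        rw [← (Finset.mem_filter.1 hk).2]
        simp only [hx, Pi.smul_apply, smul_eq_mul, mul_pow, Finset.prod_mul_distrib,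
          Finset.prod_pow_eq_pow_sum]
        ring) hl
  choose! a ha hsa using hpsum
  have h0ρ : (0 : ℂ) ∈ Metric.ball (0 : ℂ) ρ := Metric.mem_ball_self hρ
  obtain ⟨G, hG, hGt⟩ := exists_polynomial_prod_sub_eq (D := D)
    (infinite_of_mem_nhds 0 (Metric.ball_mem_nhds (0 : ℂ) hR))
    (fun j t => c (w j (x 0 t)))
    (fun l => ∑ i ∈ Finset.range (l + D + 1), C (a l i 0) * X ^ i)
    (fun l _ => natDegree_sum_le_of_forall_le _ _ fun i hi =>
      (natDegree_C_mul_X_pow_le _ _).trans (by simpa [Nat.lt_succ_iff] using hi))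
    (fun l hl t ht => by
      rw [hsa l hl 0 h0ρ t ht]
      simp [eval_finsetSum]) z
  exact ⟨G, hG, fun t ht => by simpa [hx] using hGt t ht⟩

theorem offset_smul (α : Fin q → Fin m → ℂ) (t : ℂ) (ζ : Fin (q + m) → ℂ) :
    offset α (t • ζ) = t • offset α ζ := by
  funext k
  simp only [offset, Pi.smul_apply, smul_eq_mul, mul_sub, Finset.mul_sum]
  congr 1
  exact Finset.sum_congr rfl fun r _ => by ring

theorem continuous_offset (α : Fin q → Fin m → ℂ) : Continuous (offset α) := by
  unfold offset; fun_prop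

/-- For fixed `α`, the function `∏ j, (c (tail ζ) - c (w j (α, β)))` of `ζ ∈ L_{α,β}`, with `β`
small, is the restriction of a polynomial in `ζ` of degree at most `d + D`. -/
theorem exists_mvPolynomial_prod_branch {d D : ℕ} {δ : ℝ} (hδ : 0 < δ)
    {w : Fin d → (Fin q → Fin m → ℂ) × (Fin q → ℂ) → (Fin m → ℂ)} (hw : ∀ j, IsBranch δ (w j))
    {h : Fin m → (Fin q → ℕ) → (Fin q → Fin m → ℂ) → ℂ}
    (hh : ∀ l, ∀ k ∈ multiIndices q (D + 1), ∀ α : Fin q → Fin m → ℂ, ‖α‖ < δ →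
      AnalyticAt ℂ (h l k) α)
    (hsum : ∀ x ∈ paramBall q m δ, ∀ l : Fin m,
      ∑ j, w j x l = ∑ k ∈ multiIndices q (D + 1), h l k x.1 * ∏ i, x.2 i ^ k i)
    {α : Fin q → Fin m → ℂ} (hα : ‖α‖ < δ) (c : (Fin m → ℂ) →L[ℂ] ℂ) :
    ∃ F : MvPolynomial (Fin (q + m)) ℂ, F.totalDegree ≤ d + D ∧
      ∀ ζ, ‖offset α ζ‖ < δ →
        MvPolynomial.eval ζ F = ∏ j, (c (tail ζ) - c (w j (α, offset α ζ))) := by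
  set f : (Fin (q + m) → ℂ) → ℂ := fun ζ => ∏ j, (c (tail ζ) - c (w j (α, offset α ζ))) with hf
  have hline : ∀ (ξ : Fin (q + m) → ℂ) (R : ℝ), 0 < R →
      (∀ t ∈ Metric.ball (0 : ℂ) R, ‖t • offset α ξ‖ < δ) →
      ∃ G : Polynomial ℂ, G.natDegree ≤ d + D ∧
        ∀ t ∈ Metric.ball (0 : ℂ) R, f (t • ξ) = G.eval t := by
    intro ξ R hR hξ
    obtain ⟨G, hG, hGt⟩ :=
      exists_polynomial_prod_branch hw hh hsum hα (offset α ξ) hR hξ c (c (tail ξ))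
    refine ⟨G, hG, fun t ht => ?_⟩
    rw [← hGt t ht]
    refine Finset.prod_congr rfl fun j _ => ?_
    have h1 : tail (t • ξ) = t • tail ξ := rfl
    rw [h1, offset_smul, map_smul, smul_eq_mul, mul_comm]
  have hzero : offset α (0 : Fin (q + m) → ℂ) = 0 := by
    have := offset_smul α 0 0
    simpa using this
  have hana : AnalyticAt ℂ f 0 := by
    refine Finset.analyticAt_fun_prod _ fun j _ => AnalyticAt.sub ?_ ?_
    · refine (c.analyticAt _).comp (f := tail) ?_
      exact AnalyticAt.pi fun r => (ContinuousLinearMap.proj (R := ℂ)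
        (φ := fun _ : Fin (q + m) => ℂ) (Fin.natAdd q r)).analyticAt _
    · refine (c.analyticAt _).comp ?_
      refine AnalyticAt.comp (g := w j) (f := fun ζ => (α, offset α ζ)) ?_ ?_
      · exact (hw j).analyticAt _ ⟨hα, by simpa [hzero] using hδ⟩
      · refine analyticAt_const.prod (AnalyticAt.pi fun k => ?_)
        refine AnalyticAt.sub ((ContinuousLinearMap.proj (R := ℂ)
          (φ := fun _ : Fin (q + m) => ℂ) (Fin.castAdd m k)).analyticAt _)
          (Finset.analyticAt_fun_sum _ fun r _ => analyticAt_const.mul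
            ((ContinuousLinearMap.proj (R := ℂ)
              (φ := fun _ : Fin (q + m) => ℂ) (Fin.natAdd q r)).analyticAt _))
  obtain ⟨F, hF, hFξ⟩ := exists_mvPolynomial_of_lines (N := d + D) hana (fun ξ => by
    obtain ⟨R, hR, hRξ⟩ : ∃ R > 0, ∀ t ∈ Metric.ball (0 : ℂ) R, ‖t • offset α ξ‖ < δ := by
      have hc : Continuous fun t : ℂ => ‖t • offset α ξ‖ := by fun_prop
      have := (hc.tendsto 0).eventually_lt_const (u := δ) (by simpa using hδ)
      exact Metric.eventually_nhds_iff_ball.1 this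
    obtain ⟨G, hG, hGt⟩ := hline ξ R hR hRξ
    exact ⟨G, hG, Filter.eventually_of_mem (Metric.ball_mem_nhds 0 hR) hGt⟩)
  refine ⟨F, hF, fun ζ hζ => ?_⟩
  -- On the line through `ζ` both sides are polynomials in a disc that contains `1`.
  obtain ⟨R, hR, hRζ⟩ : ∃ R > 1, ∀ t ∈ Metric.ball (0 : ℂ) R, ‖t • offset α ζ‖ < δ := by
    have hc : Continuous fun R : ℝ => R * ‖offset α ζ‖ := by fun_prop
    have h1 := (hc.tendsto 1).eventually_lt_const (u := δ) (by simpa using hζ)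
    obtain ⟨R, hR1, hR⟩ :=
      ((h1.filter_mono nhdsWithin_le_nhds).and (self_mem_nhdsWithin (s := Set.Ioi 1))).exists
    refine ⟨R, hR, fun t ht => lt_of_le_of_lt ?_ hR1⟩
    rw [norm_smul]
    gcongr
    exact (mem_ball_zero_iff.1 ht).le
  obtain ⟨G, -, hGt⟩ := hline ζ R (by linarith) hRζ
  set H : Polynomial ℂ :=
    MvPolynomial.aeval (fun i => Polynomial.C (ζ i) * Polynomial.X) F with hH
  have hHt : ∀ t : ℂ, H.eval t = MvPolynomial.eval (t • ζ) F := by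
    intro t
    rw [hH, ← Polynomial.coe_aeval_eq_eval, MvPolynomial.comp_aeval_apply,
      ← MvPolynomial.aeval_eq_eval]
    have h1 : (fun i => Polynomial.aeval t (Polynomial.C (ζ i) * Polynomial.X)) = t • ζ := by
      funext i
      rw [Polynomial.coe_aeval_eq_eval, Polynomial.eval_C_mul, Polynomial.eval_X, mul_comm]
      rfl
    rw [h1]
  have hHG : H = G := by
    have hev : {t : ℂ | H.eval t = G.eval t} ∈ 𝓝 (0 : ℂ) := by
      filter_upwards [hFξ ζ, Metric.ball_mem_nhds (0 : ℂ) (by linarith : 0 < R)] with t ht1 ht2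
      rw [hHt, ← ht1, hGt t ht2]
    exact Polynomial.eq_of_infinite_eval_eq H G (infinite_of_mem_nhds 0 hev)
  have h1 := hHt 1
  rw [hHG, ← hGt 1 (by simpa using hR), one_smul] at h1
  exact h1.symm

end AffineWood

/-! ### Estimates and the construction of the family -/

namespace AffineWood

variable {q m : ℕ}

theorem norm_sum_mul_le (α : Fin q → Fin m → ℂ) (w : Fin m → ℂ) (k : Fin q) :
    ‖∑ r, α k r * w r‖ ≤ m * ‖α‖ * ‖w‖ := by
  have h : ∀ r ∈ Finset.univ, ‖α k r * w r‖ ≤ ‖α‖ * ‖w‖ := by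
    intro r _
    rw [norm_mul]
    gcongr
    · exact (norm_le_pi_norm (α k) r).trans (norm_le_pi_norm α k)
    · exact norm_le_pi_norm w r
  refine (norm_sum_le_of_le _ h).trans ?_
  simp [mul_assoc]

theorem norm_tail_le (ζ : Fin (q + m) → ℂ) : ‖tail ζ‖ ≤ ‖ζ‖ :=
  (pi_norm_le_iff_of_nonneg (norm_nonneg _)).2 fun r => norm_le_pi_norm ζ (Fin.natAdd q r)

theorem norm_offset_le (α : Fin q → Fin m → ℂ) (ζ : Fin (q + m) → ℂ) :
    ‖offset α ζ‖ ≤ (1 + m * ‖α‖) * ‖ζ‖ := by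
  refine (pi_norm_le_iff_of_nonneg (by positivity)).2 fun k => (norm_sub_le _ _).trans ?_
  have h1 := norm_sum_mul_le α (tail ζ) k
  have h2 := norm_le_pi_norm ζ (Fin.castAdd m k)
  have h3 : m * ‖α‖ * ‖tail ζ‖ ≤ m * ‖α‖ * ‖ζ‖ := by gcongr; exact norm_tail_le ζ
  have h4 := h1.trans h3
  simp only [tail] at h4
  linarith

theorem norm_offset_le_of_mem {α' : Fin q → Fin m → ℂ} {β' : Fin q → ℂ} {ζ : Fin (q + m) → ℂ}
    (hζ : ζ ∈ affL α' β') (α : Fin q → Fin m → ℂ) :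
    ‖offset α ζ‖ ≤ m * (‖α'‖ + ‖α‖) * ‖tail ζ‖ + ‖β'‖ := by
  refine (pi_norm_le_iff_of_nonneg (by positivity)).2 fun k => ?_
  have h1 := norm_sum_mul_le α (tail ζ) k
  have h2 := norm_sum_mul_le α' (tail ζ) k
  have h3 := norm_le_pi_norm β' k
  simp only [tail] at h1 h2
  rw [offset, hζ k]
  refine (norm_sub_le _ _).trans ?_
  have h4 := norm_add_le (∑ r, α' k r * ζ (Fin.natAdd q r)) (β' k)
  linarith

theorem norm_le_of_mem_affL {α : Fin q → Fin m → ℂ} {β : Fin q → ℂ} {ζ : Fin (q + m) → ℂ}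
    (hζ : ζ ∈ affL α β) (hα : m * ‖α‖ ≤ 1) : ‖ζ‖ ≤ ‖tail ζ‖ + ‖β‖ := by
  refine (pi_norm_le_iff_of_nonneg (by positivity)).2 fun i => ?_
  refine Fin.addCases (fun k => ?_) (fun r => ?_) i
  · rw [hζ k]
    have h1 := norm_sum_mul_le α (tail ζ) k
    have h2 : m * ‖α‖ * ‖tail ζ‖ ≤ 1 * ‖tail ζ‖ := by gcongr
    refine (norm_add_le _ _).trans (add_le_add ?_ (norm_le_pi_norm β k))
    have h3 := h1.trans h2
    rwa [one_mul] at h3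
  · have := norm_le_pi_norm (tail ζ) r
    have h0 := norm_nonneg β
    simp only [tail] at this ⊢
    linarith

theorem euclNorm_le {n : ℕ} (ζ : Fin n → ℂ) : euclNorm ζ ≤ n * ‖ζ‖ := by
  rw [euclNorm, EuclideanSpace.norm_eq]
  refine Real.sqrt_le_iff.2 ⟨by positivity, ?_⟩
  have h1 : ∀ i ∈ Finset.univ, ‖(WithLp.toLp 2 ζ : EuclideanSpace ℂ (Fin n)) i‖ ^ 2 ≤ ‖ζ‖ ^ 2 :=
    fun i _ => pow_le_pow_left₀ (norm_nonneg _) (norm_le_pi_norm ζ i) 2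
  refine (Finset.sum_le_sum h1).trans ?_
  rw [Finset.sum_const, Finset.card_univ, Fintype.card_fin, nsmul_eq_mul, mul_pow]
  gcongr
  exact_mod_cast Nat.le_self_pow two_ne_zero n

theorem exists_norm_le_coord (hm : 1 ≤ m) (w : Fin m → ℂ) : ∃ r, ‖w‖ ≤ ‖w r‖ := by
  have : Nonempty (Fin m) := ⟨⟨0, hm⟩⟩
  obtain ⟨r, hr⟩ := Finite.exists_max fun r => ‖w r‖
  exact ⟨r, (pi_norm_le_iff_of_nonneg (norm_nonneg _)).2 hr⟩

/-- The polynomials of degree at most `N` that vanish on a set. -/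
def vanishingSubmodule {n : ℕ} (N : ℕ) (Z : Set (Fin n → ℂ)) :
    Submodule ℂ (MvPolynomial (Fin n) ℂ) where
  carrier := {F | F.totalDegree ≤ N ∧ ∀ ζ ∈ Z, MvPolynomial.eval ζ F = 0}
  zero_mem' := by simp
  add_mem' := by
    rintro F G ⟨hF, hF0⟩ ⟨hG, hG0⟩
    exact ⟨(MvPolynomial.totalDegree_add F G).trans (max_le hF hG),
      fun ζ hζ => by rw [map_add, hF0 ζ hζ, hG0 ζ hζ, add_zero]⟩
  smul_mem' := by
    rintro c F ⟨hF, hF0⟩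
    exact ⟨(MvPolynomial.totalDegree_smul_le c F).trans hF,
      fun ζ hζ => by rw [MvPolynomial.smul_eval, hF0 ζ hζ, mul_zero]⟩

/-- A point of `L_{α,β}` far from the origin has a last coordinate that is large, hence far from the
corresponding coordinates of any `d` bounded points. -/
theorem exists_pow_le_prod_norm_sub {d : ℕ} (hm : 1 ≤ m) {α : Fin q → Fin m → ℂ} {β : Fin q → ℂ}
    {ζ : Fin (q + m) → ℂ} (hζ : ζ ∈ affL α β) (hα : m * ‖α‖ ≤ 1) (hβ : ‖β‖ ≤ 1) {C : ℝ}
    {w : Fin d → Fin m → ℂ} (hw : ∀ j, ‖w j‖ ≤ C)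
    (hK : 2 * ((q + m : ℕ) : ℝ) * (1 + C) ≤ euclNorm ζ) :
    ∃ r, (1 / (2 * ((q + m : ℕ) : ℝ)) * euclNorm ζ) ^ d ≤ ∏ j, ‖tail ζ r - w j r‖ := by
  obtain ⟨r, hr⟩ := exists_norm_le_coord hm (tail ζ)
  set n : ℝ := ((q + m : ℕ) : ℝ) with hn
  have hn0 : 0 < n := by rw [hn]; exact_mod_cast (by omega : 0 < q + m)
  set T := euclNorm ζ with hT
  have hT0 : 0 ≤ T := norm_nonneg _
  have hnorm : T / n - 1 ≤ ‖tail ζ‖ := by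
    have h1 := norm_le_of_mem_affL hζ hα
    have h2 : T / n ≤ ‖ζ‖ := by
      rw [div_le_iff₀ hn0, mul_comm]
      exact euclNorm_le ζ
    linarith
  refine ⟨r, le_trans (by simp) (Finset.prod_le_prod (f := fun _ : Fin d => (1 / (2 * n)) * T)
    (fun _ _ => by positivity) fun j _ => ?_)⟩
  have h1 := norm_sub_norm_le (tail ζ r) (w j r)
  have h2 : ‖w j r‖ ≤ C := (norm_le_pi_norm _ r).trans (hw j)
  have h4 : 1 + C ≤ (1 / (2 * n)) * T := by
    rw [one_div, inv_mul_eq_div, le_div_iff₀ (by positivity)]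
    linarith
  have h5 : T / n = 2 * ((1 / (2 * n)) * T) := by field_simp
  linarith

/-- The hypotheses near `(0, 0)`, collected on one ball of parameters. -/
theorem exists_paramBall {d D : ℕ} {γ : Fin d → Set (Fin (q + m) → ℂ)}
    {p : Fin d → (Fin q → Fin m → ℂ) → (Fin q → ℂ) → (Fin (q + m) → ℂ)}
    (hp : ∀ᶠ x : (Fin q → Fin m → ℂ) × (Fin q → ℂ) in 𝓝 (0, 0), ∀ j,
      affL x.1 x.2 ∩ γ j = {p j x.1 x.2} ∧ IsTransversalAt m (γ j) (dirL x.1) (p j x.1 x.2))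
    {h : Fin m → (Fin q → ℕ) → (Fin q → Fin m → ℂ) → ℂ}
    (hh : ∀ l, ∀ k ∈ multiIndices q (D + 1), AnalyticAt ℂ (h l k) 0)
    (hsum : ∀ᶠ x : (Fin q → Fin m → ℂ) × (Fin q → ℂ) in 𝓝 (0, 0), ∀ l : Fin m,
      ∑ j, p j x.1 x.2 (Fin.natAdd q l) =
        ∑ k ∈ multiIndices q (D + 1), h l k x.1 * ∏ i, x.2 i ^ k i) :
    ∃ δ C : ℝ, 0 < δ ∧ 0 ≤ C ∧
      (∀ x ∈ paramBall q m δ, ∀ j, affL x.1 x.2 ∩ γ j = {p j x.1 x.2}) ∧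
      (∀ j, IsBranch δ fun x : (Fin q → Fin m → ℂ) × (Fin q → ℂ) => tail (p j x.1 x.2)) ∧
      (∀ x ∈ paramBall q m δ, ∀ j, ‖tail (p j x.1 x.2)‖ ≤ C) ∧
      (∀ l, ∀ k ∈ multiIndices q (D + 1), ∀ α : Fin q → Fin m → ℂ, ‖α‖ < δ →
        AnalyticAt ℂ (h l k) α) ∧
      ∀ x ∈ paramBall q m δ, ∀ l : Fin m, ∑ j, tail (p j x.1 x.2) l =
        ∑ k ∈ multiIndices q (D + 1), h l k x.1 * ∏ i, x.2 i ^ k i := by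
  set w : Fin d → (Fin q → Fin m → ℂ) × (Fin q → ℂ) → (Fin m → ℂ) :=
    fun j x => tail (p j x.1 x.2) with hw
  have hana : ∀ j, AnalyticAt ℂ (w j) (0, 0) := fun j =>
    analyticAt_tail (hp.mono fun x hx => (hx j).1) (hp.self_of_nhds j).2
  set C : ℝ := ∑ j, (‖w j (0, 0)‖ + 1) with hC
  have hC0 : 0 ≤ C := Finset.sum_nonneg fun _ _ => by positivity
  have hbound : ∀ᶠ x in 𝓝 (0, 0), ∀ j, ‖w j x‖ ≤ C := by
    refine eventually_all.2 fun j => ?_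
    have h1 : ‖w j (0, 0)‖ < C := lt_of_lt_of_le (lt_add_one _)
      (Finset.single_le_sum (f := fun j => ‖w j (0, 0)‖ + 1) (fun _ _ => by positivity)
        (Finset.mem_univ j))
    filter_upwards [(hana j).continuousAt.norm.tendsto.eventually_lt_const h1] with x hx
    exact hx.le
  have hhe : ∀ᶠ α : Fin q → Fin m → ℂ in 𝓝 0, ∀ l, ∀ k ∈ multiIndices q (D + 1),
      AnalyticAt ℂ (h l k) α :=
    eventually_all.2 fun l => (Finset.eventually_all _).2 fun k hk =>
      (hh l k hk).eventually_analyticAt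
  have hgood := hp.and (hsum.and (hbound.and
    ((eventually_all.2 fun j => (hana j).eventually_analyticAt).and
      (continuous_fst.continuousAt.tendsto.eventually hhe))))
  obtain ⟨δ, hδ, hδgood⟩ := Metric.eventually_nhds_iff_ball.1 hgood
  have hball : ∀ x ∈ paramBall q m δ, x ∈ Metric.ball ((0, 0) :
      (Fin q → Fin m → ℂ) × (Fin q → ℂ)) δ := by
    intro x hx
    have h0 : ((0, 0) : (Fin q → Fin m → ℂ) × (Fin q → ℂ)) = 0 := rfl
    rw [h0, mem_ball_zero_iff, Prod.norm_def]
    exact max_lt hx.1 hx.2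
  have hpt : ∀ x ∈ paramBall q m δ, ∀ j, affL x.1 x.2 ∩ γ j = {p j x.1 x.2} :=
    fun x hx j => ((hδgood x (hball x hx)).1 j).1
  refine ⟨δ, C, hδ, hC0, hpt, fun j => ?_, fun x hx => (hδgood x (hball x hx)).2.2.1,
    fun l k hk α hα => (hδgood (α, 0) (hball _ ⟨hα, by simpa using hδ⟩)).2.2.2.2 l k hk,
    fun x hx => (hδgood x (hball x hx)).2.1⟩
  exact
    { analyticAt := fun x hx => (hδgood x (hball x hx)).2.2.2.1 j
      eq_of_mem := fun x hx y hy hxy => by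
        have h1 := hpt x hx j ▸ Set.mem_singleton (p j x.1 x.2)
        rw [← eq_affPoint h1.1] at hxy
        have h2 : p j x.1 x.2 ∈ affL y.1 y.2 ∩ γ j := ⟨hxy, h1.2⟩
        rw [hpt y hy j] at h2
        exact congrArg tail h2.symm }

end AffineWood

open AffineWood in
theorem proposition5p2 (q m d D : ℕ) (hq : 1 ≤ q) (hm : 1 ≤ m)
    (γ : Fin d → Set (Fin (q + m) → ℂ))
    (hγ : ∀ j, AffineWood.IsAnalyticPiece m (γ j))
    (hdisj : Pairwise fun i j => Disjoint (γ i) (γ j))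
    (p : Fin d → (Fin q → Fin m → ℂ) → (Fin q → ℂ) → (Fin (q + m) → ℂ))
    (hp : ∀ᶠ x : (Fin q → Fin m → ℂ) × (Fin q → ℂ) in 𝓝 (0, 0), ∀ j,
      AffineWood.affL x.1 x.2 ∩ γ j = {p j x.1 x.2} ∧
      AffineWood.IsTransversalAt m (γ j) (AffineWood.dirL x.1) (p j x.1 x.2))
    (h : Fin m → (Fin q → ℕ) → (Fin q → Fin m → ℂ) → ℂ)
    (hh : ∀ l, ∀ k ∈ AffineWood.multiIndices q (D + 1), AnalyticAt ℂ (h l k) 0)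
    (hsum : ∀ᶠ x : (Fin q → Fin m → ℂ) × (Fin q → ℂ) in 𝓝 (0, 0), ∀ l : Fin m,
      ∑ j, p j x.1 x.2 (Fin.natAdd q l) =
        ∑ k ∈ AffineWood.multiIndices q (D + 1), h l k x.1 * ∏ i, x.2 i ^ k i) :
    ∃ (N : ℕ) (P : Fin N → MvPolynomial (Fin (q + m)) ℂ),
      (∀ ι, (P ι).totalDegree ≤ d + D) ∧
      ∃ ε κ K : ℝ, 0 < ε ∧ 0 < κ ∧ 0 < K ∧
        (∀ ζ ∈ AffineWood.tube q m ε, K ≤ AffineWood.euclNorm ζ →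
          ∃ ι, κ * AffineWood.euclNorm ζ ^ d ≤ ‖MvPolynomial.eval ζ (P ι)‖) ∧
        ∀ (α : Fin q → Fin m → ℂ) (β : Fin q → ℂ), max ‖α‖ ‖β‖ < ε →
          AffineWood.affL α β ∩ AffineWood.zeroSet P = Set.range fun j => p j α β := by
  obtain ⟨δ, C, hδ, hC0, hpt, hbranch, hwC, hhan, hwsum⟩ := exists_paramBall hp hh hsum
  set w : Fin d → (Fin q → Fin m → ℂ) × (Fin q → ℂ) → (Fin m → ℂ) :=
    fun j x => tail (p j x.1 x.2) with hw
  replace hwC : ∀ x ∈ paramBall q m δ, ∀ j, ‖w j x‖ ≤ C := hwC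
  have hpmem : ∀ x ∈ paramBall q m δ, ∀ j, p j x.1 x.2 ∈ affL x.1 x.2 ∩ γ j :=
    fun x hx j => (hpt x hx j) ▸ rfl
  have hp_eq : ∀ x ∈ paramBall q m δ, ∀ y ∈ paramBall q m δ, ∀ j,
      p j x.1 x.2 ∈ affL y.1 y.2 → p j x.1 x.2 = p j y.1 y.2 := by
    intro x hx y hy j hxy
    have h1 : p j x.1 x.2 ∈ affL y.1 y.2 ∩ γ j := ⟨hxy, (hpmem x hx j).2⟩
    rwa [hpt y hy j] at h1
  have hpoly := fun (α : Fin q → Fin m → ℂ) (hα : ‖α‖ < δ) (c : (Fin m → ℂ) →L[ℂ] ℂ) =>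
    exists_mvPolynomial_prod_branch (D := D) hδ hbranch hhan hwsum hα c
  choose! F hFdeg hFeval using hpoly
  -- For parameters below `ε`, every `L_{α,β'}` that contains one of the points `p j α' β'` has
  -- `‖β'‖ < δ`.
  obtain ⟨ε, hε, hεm, hε1, hεδ, hεC⟩ : ∃ ε : ℝ, 0 < ε ∧ m * ε ≤ 1 ∧ ε ≤ 1 ∧ ε ≤ δ ∧
      m * (ε + ε) * C + ε < δ := by
    refine ⟨min (1 / (m + 1)) (δ / (2 * m * C + 2)), by positivity, ?_, ?_, ?_, ?_⟩
    all_goals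
      have h1 := min_le_left (1 / ((m : ℝ) + 1)) (δ / (2 * m * C + 2))
      have h2 := min_le_right (1 / ((m : ℝ) + 1)) (δ / (2 * m * C + 2))
      have h0 : 0 < min (1 / ((m : ℝ) + 1)) (δ / (2 * m * C + 2)) := by positivity
      set ε := min (1 / ((m : ℝ) + 1)) (δ / (2 * m * C + 2))
      rw [le_div_iff₀ (by positivity)] at h1 h2
      have h3 : 0 ≤ (m : ℝ) * ε := by positivity
      have h4 : 0 ≤ ε * (m * C) := by positivity
      nlinarith
  set Z : Set (Fin (q + m) → ℂ) := {ζ | ∃ j α β, ‖α‖ < ε ∧ ‖β‖ < ε ∧ p j α β = ζ} with hZ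
  set W := vanishingSubmodule (d + D) Z with hW
  have hFW : ∀ α : Fin q → Fin m → ℂ, ‖α‖ < ε → ∀ c, F α c ∈ W := by
    intro α hα c
    refine ⟨hFdeg α (hα.trans_le hεδ) c, ?_⟩
    rintro _ ⟨j, α', β', hα', hβ', rfl⟩
    have hx : (α', β') ∈ paramBall q m δ := ⟨hα'.trans_le hεδ, hβ'.trans_le hεδ⟩
    have hmem := (hpmem _ hx j).1
    have hoff : ‖offset α (p j α' β')‖ < δ := by
      refine (norm_offset_le_of_mem hmem α).trans_lt (lt_of_le_of_lt ?_ hεC)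
      gcongr
      exact hwC _ hx j
    have hy : (α, offset α (p j α' β')) ∈ paramBall q m δ := ⟨hα.trans_le hεδ, hoff⟩
    rw [hFeval α (hα.trans_le hεδ) c _ hoff]
    refine Finset.prod_eq_zero (Finset.mem_univ j) (sub_eq_zero.2 (congrArg c ?_))
    exact congrArg tail (hp_eq _ hx _ hy j (mem_affL_iff_offset.2 rfl))
  have hr : 0 < min 1 (δ / 2) := by positivity
  obtain ⟨N, x, P, hxU, hPW, hint⟩ := exists_interpolation W (fun F hF => hF.1)
    (Metric.ball_mem_nhds (0 : Fin (q + m) → ℂ) hr)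
  have hFP : ∀ α : Fin q → Fin m → ℂ, ‖α‖ < ε → ∀ c ζ, MvPolynomial.eval ζ (F α c) =
      ∑ i, MvPolynomial.eval (x i) (F α c) * MvPolynomial.eval ζ (P i) := by
    intro α hα c ζ
    conv_lhs => rw [hint _ (hFW α hα c)]
    simp [MvPolynomial.smul_eval]
  -- The coefficients are bounded uniformly in `α`, as `F α c` is bounded near the origin.
  have hcoef : ∀ α : Fin q → Fin m → ℂ, ‖α‖ < ε → ∀ c : (Fin m → ℂ) →L[ℂ] ℂ,
      (∀ v, ‖c v‖ ≤ ‖v‖) → ∀ i, ‖MvPolynomial.eval (x i) (F α c)‖ ≤ (1 + C) ^ d := by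
    intro α hα c hc i
    have hxi := mem_ball_zero_iff.1 (hxU i)
    have hxi1 : ‖x i‖ < 1 := hxi.trans_le (min_le_left _ _)
    have hxi2 : ‖x i‖ < δ / 2 := hxi.trans_le (min_le_right _ _)
    have hαδ : ‖α‖ < δ := hα.trans_le hεδ
    have hoff : ‖offset α (x i)‖ < δ := by
      have h1 : (1 + m * ‖α‖) * ‖x i‖ ≤ (1 + 1) * ‖x i‖ := by
        gcongr
        refine le_trans ?_ hεm
        gcongr
      linarith [norm_offset_le α (x i)]
    rw [hFeval α hαδ c _ hoff, norm_prod]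
    refine (Finset.prod_le_prod (g := fun _ => 1 + C) (fun _ _ => norm_nonneg _)
      fun j _ => ?_).trans (by simp)
    refine (norm_sub_le _ _).trans (add_le_add ?_ ?_)
    · exact (hc _).trans ((norm_tail_le _).trans hxi1.le)
    · exact (hc _).trans (hwC (α, offset α (x i)) ⟨hαδ, hoff⟩ j)
  set n : ℝ := ((q + m : ℕ) : ℝ) with hn
  have hn0 : 0 < n := by rw [hn]; exact_mod_cast (by omega : 0 < q + m)
  refine ⟨N, P, fun i => (hPW i).1, ε, (1 / (2 * n)) ^ d / ((1 + C) ^ d * N + 1),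
    2 * n * (1 + C), hε, by positivity, by positivity, ?_, ?_⟩
  · rintro ζ ⟨α, β, hαβ, hζ⟩ hK
    have hα : ‖α‖ < ε := (le_max_left _ _).trans_lt hαβ
    have hβ : ‖β‖ < ε := (le_max_right _ _).trans_lt hαβ
    have hx : (α, β) ∈ paramBall q m δ := ⟨hα.trans_le hεδ, hβ.trans_le hεδ⟩
    obtain ⟨r, hr⟩ := exists_pow_le_prod_norm_sub hm hζ (le_trans (by gcongr) hεm)
      (hβ.le.trans hε1) (hwC _ hx) hK
    set c : (Fin m → ℂ) →L[ℂ] ℂ := ContinuousLinearMap.proj r with hc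
    have hcv : ∀ v, ‖c v‖ ≤ ‖v‖ := fun v => norm_le_pi_norm v r
    set T := euclNorm ζ with hT
    have hT0 : 0 < T := lt_of_lt_of_le (by positivity) hK
    have hlow : ((1 / (2 * n)) * T) ^ d ≤ ‖MvPolynomial.eval ζ (F α c)‖ := by
      have hoff : offset α ζ = β := mem_affL_iff_offset.1 hζ
      rw [hFeval α hx.1 c ζ (by rw [hoff]; exact hx.2), hoff, norm_prod]
      exact hr
    by_contra! hcon
    set κ := (1 / (2 * n)) ^ d / ((1 + C) ^ d * N + 1) with hκ
    have hκ0 : 0 < κ := by positivity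
    have hup : ‖MvPolynomial.eval ζ (F α c)‖ ≤ (1 + C) ^ d * N * (κ * T ^ d) := by
      rw [hFP α hα c ζ]
      refine (norm_sum_le_of_le _ (n := fun _ => (1 + C) ^ d * (κ * T ^ d)) fun i _ => ?_).trans ?_
      · rw [norm_mul]
        gcongr
        · exact hcoef α hα c hcv i
        · exact (hcon i).le
      · simp only [Finset.sum_const, Finset.card_univ, Fintype.card_fin, nsmul_eq_mul]
        exact le_of_eq (by ring)
    have hκe : ((1 + C) ^ d * N + 1) * κ = (1 / (2 * n)) ^ d := by
      rw [hκ]; field_simp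
    have h1 : ((1 / (2 * n)) * T) ^ d = ((1 + C) ^ d * N + 1) * κ * T ^ d := by
      rw [hκe, mul_pow]
    have h2 : 0 < κ * T ^ d := by positivity
    linarith [hlow.trans hup]
  · intro α β hαβ
    have hα : ‖α‖ < ε := (le_max_left _ _).trans_lt hαβ
    have hβ : ‖β‖ < ε := (le_max_right _ _).trans_lt hαβ
    have hx : (α, β) ∈ paramBall q m δ := ⟨hα.trans_le hεδ, hβ.trans_le hεδ⟩
    ext ζ
    constructor
    · rintro ⟨hζ, hζ0⟩
      have hoff : offset α ζ = β := mem_affL_iff_offset.1 hζ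
      by_contra hne
      have hv : ∀ j, tail ζ - w j (α, β) ≠ 0 := by
        intro j hj
        refine hne ⟨j, ?_⟩
        have h1 := eq_affPoint (hpmem _ hx j).1
        have h2 := eq_affPoint hζ
        rw [sub_eq_zero.1 hj] at h2
        exact h1.trans h2.symm
      -- A linear form that separates `tail ζ` from the finitely many values of the branches.
      obtain ⟨c, hc⟩ := Module.exists_dual_forall_apply_ne_zero (K := ℂ) _ hv
      have h1 := hFeval α hx.1 (LinearMap.toContinuousLinearMap c) ζ (by rw [hoff]; exact hx.2)
      rw [hFP α hα, Finset.sum_eq_zero (fun i _ => by rw [hζ0 i, mul_zero]), hoff] at h1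
      obtain ⟨j, -, hj⟩ := Finset.prod_eq_zero_iff.1 h1.symm
      exact hc j (by rw [map_sub]; exact hj)
    · rintro ⟨j, rfl⟩
      exact ⟨(hpmem _ hx j).1, fun i => (hPW i).2 _ ⟨j, α, β, hα, hβ, rfl⟩⟩
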